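/- Let $T$ be the set of finite rooted trees up to isomorphism (of rooted trees), $|t|$ the number of vertices of $t$, and $[t_1\cdots t_m]$ the tree obtained by joining the roots of $t_1,\dots,t_m$ to a new root ($\tau$, the one-vertex tree, for $m=0$). Let $\sigma(\tau)=1$ and $\sigma([t_1^{k_1}\cdots t_m^{k_m}])=\prod_i k_i!\,\sigma(t_i)^{k_i}$ for distinct $t_i$. For $f\in C^\infty(\mathbb R^d,\mathbb R^d)$ define the elementary differentials $F(t):\mathbb R^d\to\mathbb R^d$ by $F([t_1\cdots t_m])(y)=f^{(m)}(y)\big(F(t_1)(y),\dots,F(t_m)(y)\big)$ (so $F(\tau)=f$). Let $B^*$ be the set of all maps $\{\varnothing\}\cup T\to\mathbb R$ and $B=\{a\in B^*: a(\varnothing)=1\}$. For $a\in B^*$ the B-series at $y_0\in\mathbb R^d$ is the formal power series in $h$ $$(B_h y_0)a=a(\varnothing)\,y_0+\sum_{t\in T}\frac{h^{|t|}a(t)}{\sigma(t)}F(t)(y_0).$$ The same formula defines $(B_h Y)a$ for a formal series $Y=\sum_{k\ge 0} h^kY_k$ with $Y_k\in\mathbb R^d$, where for a smooth $g:\mathbb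 R^d\to\mathbb R^d$ the formal series $g(Y)$ is given by the Taylor expansion $\sum_{m\ge0}\frac1{m!}g^{(m)}(Y_0)(\delta,\dots,\delta)$, $\delta=\sum_{k\ge1}h^kY_k$. For trees $t',t$ with vertex sets $V',V$, let $\Pi(t',t)$ be the set of injective maps $\pi:V'\to V$ that send the root to the root and edges to edges, and write $t'\le t$ if $\Pi(t',t)\neq\emptyset$. The pruning $t\setminus t'$ is the formal sum, over the distinct vertex sets $S=\pi(V')$, $\pi\in\Pi(t',t)$, of the forest (commutative product of rooted trees) induced by $t$ on $V\setminus S$, each component being rooted at its vertex nearest to the root of $t$. Each $a\in B$ is extended to formal linear combinations of forests as an algebra homomorphism, so that $a$ of a forest is the product of the values at its trees and $a$ of the empty forest is $1$. **Theorem.** Let $a\in B$ and $b\in B^*$, and let $ab\in B^*$ be the map $$(ab)(\varnothing)=b(\varnothing),\qquad (ab)(t)=b(\varnothing)\,a(t)+\sum_{t'\le t}b(t')\,a(t\setminus t')\quad(t\in T).$$ Then for every $d$, every $f\in C^\infty(\mathbb R^d,\mathbb R^d)$ and every $y_0\in\mathbb R^d$, $$\big(B_h\,(B_h y_0)a\big)\,b=(B_h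 y_0)(ab)$$ as formal power series in $h$. -/

import Mathlib

namespace BSeries

/-! ### Rooted trees -/

/-- Ordered (plane) rooted trees: a root together with a finite family of branches.
They only serve as concrete representatives of unordered rooted trees; every finite rooted tree is
isomorphic to one of them (see `PlaneTree.Iso`). -/
inductive PlaneTree : Type
  | node (n : ℕ) (c : Fin n → PlaneTree) : PlaneTree

namespace PlaneTree

/-- The vertices of a tree: the root, and the vertices of the branches. -/
inductive Vert : PlaneTree → Type
  | root (t : PlaneTree) : Vert t
  | inBranch {n : ℕ} {c : Fin n → PlaneTree} (i : Fin n) (v : Vert (c i)) : Vert (node n c)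

/-- The edges of a tree, directed away from the root: `IsChild u v` says that `v` is a child
of `u`. -/
inductive IsChild : {t : PlaneTree} → Vert t → Vert t → Prop
  | root {n : ℕ} {c : Fin n → PlaneTree} (i : Fin n) :
      IsChild (Vert.root (node n c)) (Vert.inBranch i (Vert.root (c i)))
  | step {n : ℕ} {c : Fin n → PlaneTree} (i : Fin n) {u v : Vert (c i)} (h : IsChild u v) :
      IsChild (Vert.inBranch (c := c) i u) (Vert.inBranch i v)

/-- The branch at a vertex: the tree consisting of the vertex and all its descendants. -/
def branch : {t : PlaneTree} → Vert t → PlaneTree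
  | t, .root _ => t
  | _, .inBranch _ v => branch v

instance finite_vert : (t : PlaneTree) → Finite (Vert t)
  | node n c => by
    have : ∀ i, Finite (Vert (c i)) := fun i => finite_vert (c i)
    refine Finite.of_surjective
      (fun o : Option (Σ i : Fin n, Vert (c i)) =>
        (match o with
          | none => Vert.root _
          | some ⟨i, v⟩ => Vert.inBranch i v : Vert (node n c))) ?_
    intro v
    cases v with
    | root => exact ⟨none, rfl⟩
    | inBranch i v => exact ⟨some ⟨i, v⟩, rfl⟩

noncomputable instance (t : PlaneTree) : Fintype (Vert t) := Fintype.ofFinite _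

/-- The number of vertices. -/
noncomputable def order (t : PlaneTree) : ℕ := Fintype.card (Vert t)

/-- Isomorphisms of rooted trees (disregarding the order of the branches). -/
structure Iso (p q : PlaneTree) where
  toEquiv : Vert p ≃ Vert q
  map_root : toEquiv (Vert.root p) = Vert.root q
  map_child : ∀ u v, IsChild u v ↔ IsChild (toEquiv u) (toEquiv v)

namespace Iso

def refl (p : PlaneTree) : Iso p p := ⟨Equiv.refl _, rfl, fun _ _ => Iff.rfl⟩

def symm {p q : PlaneTree} (e : Iso p q) : Iso q p :=
  ⟨e.toEquiv.symm, by rw [Equiv.symm_apply_eq, e.map_root], fun u v => by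
    rw [e.map_child, Equiv.apply_symm_apply, Equiv.apply_symm_apply]⟩

def trans {p q r : PlaneTree} (e : Iso p q) (f : Iso q r) : Iso p r :=
  ⟨e.toEquiv.trans f.toEquiv, by simp [e.map_root, f.map_root], fun u v => by
    rw [e.map_child, f.map_child]; rfl⟩

end Iso

/-- Two trees are identified if they are isomorphic as rooted trees. -/
instance setoid : Setoid PlaneTree where
  r p q := Nonempty (Iso p q)
  iseqv := ⟨fun p => ⟨Iso.refl p⟩, fun ⟨e⟩ => ⟨e.symm⟩, fun ⟨e⟩ ⟨f⟩ => ⟨e.trans f⟩⟩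

end PlaneTree

open PlaneTree

/-- (Unordered, unlabelled) rooted trees: isomorphism classes of finite rooted trees. -/
def RTree : Type := Quotient PlaneTree.setoid

/-- The isomorphism class of a plane tree. -/
def RTree.mk (p : PlaneTree) : RTree := Quotient.mk _ p

theorem RTree.mk_eq_iff {p q : PlaneTree} : RTree.mk p = RTree.mk q ↔ Nonempty (Iso p q) :=
  Quotient.eq (r := PlaneTree.setoid)

/-! ### Isomorphisms and branches -/

namespace PlaneTree

theorem reach : {t : PlaneTree} → (v : Vert t) → Relation.ReflTransGen IsChild (Vert.root t) v
  | _, .root _ => .refl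
  | _, .inBranch i v => .head (IsChild.root i) ((reach v).lift _ fun _ _ h => IsChild.step i h)

theorem isChild_inBranch {n : ℕ} {c : Fin n → PlaneTree} {i : Fin n} {u v : Vert (c i)} :
    IsChild (Vert.inBranch (c := c) i u) (Vert.inBranch i v) ↔ IsChild u v :=
  ⟨fun h => by cases h; assumption, IsChild.step i⟩

theorem Iso.map_inBranch {n m : ℕ} {c : Fin n → PlaneTree} {d : Fin m → PlaneTree}
    (e : Iso (node n c) (node m d)) {i : Fin n} {j : Fin m}
    (h : e.toEquiv (.inBranch i (.root _)) = .inBranch j (.root _)) (v : Vert (c i)) :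
    ∃ w : Vert (d j), e.toEquiv (.inBranch i v) = .inBranch j w := by
  induction reach v with
  | refl => exact ⟨_, h⟩
  | tail _ hc ih =>
    obtain ⟨w, hw⟩ := ih
    have := (e.map_child _ _).1 (IsChild.step (c := c) i hc)
    rw [hw] at this
    generalize e.toEquiv _ = z at this
    cases this
    exact ⟨_, rfl⟩

theorem Iso.exists_root {n m : ℕ} {c : Fin n → PlaneTree} {d : Fin m → PlaneTree}
    (e : Iso (node n c) (node m d)) (i : Fin n) :
    ∃ j, e.toEquiv (.inBranch i (.root _)) = .inBranch j (.root _) := by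
  have := (e.map_child _ _).1 (IsChild.root (c := c) i)
  rw [e.map_root] at this
  generalize e.toEquiv _ = z at this
  cases this
  exact ⟨_, rfl⟩

/-- An isomorphism restricts to isomorphisms between the branches at the root. -/
theorem Iso.restrict {n m : ℕ} {c : Fin n → PlaneTree} {d : Fin m → PlaneTree}
    (e : Iso (node n c) (node m d)) {i : Fin n} {j : Fin m}
    (h : e.toEquiv (.inBranch i (.root _)) = .inBranch j (.root _)) :
    ∃ e' : Iso (c i) (d j), ∀ v, e.toEquiv (.inBranch i v) = .inBranch j (e'.toEquiv v) := by
  have h' : e.symm.toEquiv (.inBranch j (.root _)) = .inBranch i (.root _) := by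
    change e.toEquiv.symm _ = _
    rw [Equiv.symm_apply_eq, h]
  choose F hF using e.map_inBranch h
  choose G hG using e.symm.map_inBranch h'
  have hG' : ∀ w, e.toEquiv (.inBranch i (G w)) = .inBranch j w := fun w => by
    rw [← hG w]; exact Equiv.apply_symm_apply _ _
  have inj : ∀ {k : ℕ} {b : Fin k → PlaneTree} {l : Fin k} {u v : Vert (b l)},
      Vert.inBranch (c := b) l u = .inBranch l v → u = v := by
    intro k b l u v h; cases h; rfl
  refine ⟨⟨⟨F, G, fun v => ?_, fun w => ?_⟩, ?_, fun u v => ?_⟩, hF⟩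
  · apply inj (b := c)
    apply e.toEquiv.injective
    rw [hG', hF]
  · apply inj (b := d)
    rw [← hF, hG']
  · apply inj (b := d)
    change Vert.inBranch j (F _) = _
    rw [← hF, h]
  · change IsChild u v ↔ IsChild (F u) (F v)
    rw [← isChild_inBranch (c := c), e.map_child, hF, hF, isChild_inBranch]

/-- Isomorphic trees have the same branches at the root, up to order. -/
theorem Iso.exists_equiv {n m : ℕ} {c : Fin n → PlaneTree} {d : Fin m → PlaneTree}
    (e : Iso (node n c) (node m d)) :
    ∃ f : Fin n ≃ Fin m, ∀ i, Nonempty (Iso (c i) (d (f i))) := by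
  choose F hF using e.exists_root
  choose G hG using e.symm.exists_root
  have hG' : ∀ j, e.toEquiv (.inBranch (G j) (.root _)) = .inBranch j (.root _) := fun j => by
    rw [← hG j]; exact Equiv.apply_symm_apply _ _
  refine ⟨⟨F, G, fun i => ?_, fun j => ?_⟩, fun i => ⟨(e.restrict (hF i)).choose⟩⟩
  · have := e.toEquiv.injective ((hG' (F i)).trans (hF i).symm)
    injection this
  · have := (hF (G j)).symm.trans (hG' j)
    injection this

theorem Iso.branch : {p : PlaneTree} → (v : Vert p) → {q : PlaneTree} → (e : Iso p q) →
    Nonempty (Iso (branch v) (branch (e.toEquiv v)))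
  | p, .root _, q, e => by
    rw [e.map_root]
    simp only [PlaneTree.branch]
    exact ⟨e⟩
  | _, .inBranch i v, node m d, e => by
    obtain ⟨j, hj⟩ := e.exists_root i
    obtain ⟨e', he'⟩ := e.restrict hj
    rw [he']
    exact Iso.branch v e'

end PlaneTree

/-! ### Order and symmetry -/

/-- The order `|t|`, i.e. the number of vertices of `t`. -/
noncomputable def RTree.order : RTree → ℕ :=
  Quotient.lift PlaneTree.order fun _ _ ⟨e⟩ => Fintype.card_congr e.toEquiv

open Classical in
/-- The symmetry of a tree, `σ([t₁ ^ k₁ ⋯ tₘ ^ kₘ]) = ∏ kᵢ! σ(tᵢ) ^ kᵢ` for distinct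
(i.e. non-isomorphic) trees `tᵢ`. In particular the one-vertex tree has symmetry `1`. -/
noncomputable def PlaneTree.symmetry : PlaneTree → ℕ
  | node _ c =>
    (∏ i, (c i).symmetry) *
      ∏ T ∈ Finset.univ.image (fun i => RTree.mk (c i)),
        (Finset.univ.filter fun i => RTree.mk (c i) = T).card.factorial

theorem PlaneTree.symmetry_congr : (p q : PlaneTree) → Nonempty (Iso p q) →
    p.symmetry = q.symmetry
  | node n c, node m d, ⟨e⟩ => by
    classical
    obtain ⟨f, hf⟩ := e.exists_equiv
    have hmk : ∀ i, RTree.mk (c i) = RTree.mk (d (f i)) := fun i => RTree.mk_eq_iff.2 (hf i)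
    have him : (Finset.univ.image fun i => RTree.mk (c i)) =
        Finset.univ.image fun j => RTree.mk (d j) := by
      ext T
      simp only [Finset.mem_image, Finset.mem_univ, true_and, hmk]
      exact f.exists_congr_left.trans (by simp)
    rw [symmetry, symmetry, him]
    congr 1
    · exact Fintype.prod_equiv f _ _ fun i => symmetry_congr _ _ (hf i)
    · refine Finset.prod_congr rfl fun T _ => ?_
      congr 1
      exact Finset.card_equiv f fun i => by simp [hmk]

/-- The symmetry `σ(t)`. -/
noncomputable def RTree.symmetry : RTree → ℕ :=
  Quotient.lift PlaneTree.symmetry PlaneTree.symmetry_congr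

/-! ### Finiteness of the set of trees of a given order -/

theorem PlaneTree.order_node (n : ℕ) (c : Fin n → PlaneTree) :
    (node n c).order = 1 + ∑ i, (c i).order := by
  have e : Vert (node n c) ≃ Option (Σ i : Fin n, Vert (c i)) :=
    { toFun := fun v => match v with
        | .root _ => none
        | .inBranch i v => some ⟨i, v⟩
      invFun := fun o => match o with
        | none => .root _
        | some ⟨i, v⟩ => .inBranch i v
      left_inv := fun v => by cases v <;> rfl
      right_inv := fun o => by rcases o with _ | ⟨i, v⟩ <;> rfl }
  rw [order, Fintype.card_congr e, Fintype.card_option, Fintype.card_sigma, add_comm]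
  rfl

theorem PlaneTree.order_pos (t : PlaneTree) : 0 < t.order :=
  Fintype.card_pos_iff.2 ⟨Vert.root t⟩

theorem PlaneTree.finite_order_le (N : ℕ) : {t : PlaneTree | t.order ≤ N}.Finite := by
  induction N with
  | zero =>
    refine Set.Finite.subset Set.finite_empty fun t ht => ?_
    have := t.order_pos
    simp only [Set.mem_ofPred_eq] at ht
    omega
  | succ N ih =>
    have hfin : (⋃ k ∈ Set.Iic N, (PlaneTree.node k) ''
        (Set.univ.pi fun _ : Fin k => {t : PlaneTree | t.order ≤ N})).Finite :=
      (Set.finite_Iic N).biUnion fun _ _ => (Set.Finite.pi' fun _ => ih).image _ |>.subset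
        (Set.image_mono fun _ h i => h i trivial)
    refine hfin.subset ?_
    rintro ⟨n, c⟩ h
    simp only [Set.mem_ofPred_eq, order_node] at h
    have h1 : n ≤ ∑ i, (c i).order := by
      calc n = ∑ _i : Fin n, 1 := by simp
        _ ≤ _ := Finset.sum_le_sum fun i _ => (c i).order_pos
    refine Set.mem_biUnion (show n ∈ Set.Iic N by simp only [Set.mem_Iic]; omega) ⟨c, ?_, rfl⟩
    intro i _
    have := Finset.single_le_sum (f := fun i => (c i).order) (fun _ _ => Nat.zero_le _)
      (Finset.mem_univ i)
    simp only [Set.mem_ofPred_eq] at this ⊢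
    omega

theorem RTree.finite_order_le (N : ℕ) : {t : RTree | t.order ≤ N}.Finite := by
  refine ((PlaneTree.finite_order_le N).image RTree.mk).subset fun t ht => ?_
  induction t using Quotient.inductionOn with
  | h p => exact ⟨p, ht, rfl⟩

/-- The finite set of rooted trees of order `n`. -/
noncomputable def treesOfOrder (n : ℕ) : Finset RTree :=
  ((RTree.finite_order_le n).subset
    (show {t : RTree | t.order = n} ⊆ _ from fun _ h => le_of_eq h)).toFinset

/-! ### Subtrees and pruning -/

/-- The set `Π(t', t)` of injective maps from the vertices of `t'` to those of `t` that preserve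
the root and the edges. -/
def PlaneTree.embeddings (t' t : PlaneTree) : Set (Vert t' → Vert t) :=
  {π | Function.Injective π ∧ π (Vert.root t') = Vert.root t ∧
    ∀ u v, IsChild u v → IsChild (π u) (π v)}

/-- `t' ≤ t`: the tree `t'` is a subtree of `t` (with the same root). -/
instance : LE RTree where
  le t' t := ∃ p' p : PlaneTree, RTree.mk p' = t' ∧ RTree.mk p = t ∧ (embeddings p' p).Nonempty

theorem RTree.order_le_of_le {t' t : RTree} (h : t' ≤ t) : t'.order ≤ t.order := by
  obtain ⟨p', p, rfl, rfl, π, hπ, -⟩ := h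
  exact Fintype.card_le_of_injective π hπ

/-- The finite set of subtrees `t' ≤ t`. -/
noncomputable def RTree.subtrees (t : RTree) : Finset RTree :=
  ((RTree.finite_order_le t.order).subset
    (show {t' : RTree | t' ≤ t} ⊆ _ from fun _ h => RTree.order_le_of_le h)).toFinset

open Classical in
/-- The ways in which `t` can be pruned to form `t'`: the sets of vertices of `t` that are the
image `π(V')` of some embedding `π ∈ Π(t', t)`. -/
noncomputable def PlaneTree.copies (t' t : PlaneTree) : Finset (Finset (Vert t)) :=
  Finset.univ.filter fun S => ∃ π ∈ embeddings t' t, S = Finset.univ.image π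

/-- The forest space: the free commutative `ℝ`-algebra on the set of rooted trees. A monomial is a
forest, i.e. a finite multiset of rooted trees, and products of monomials are juxtapositions. -/
abbrev ForestSpace : Type := MvPolynomial RTree ℝ

open Classical in
/-- The forest that is left when a set `S` of vertices is cut out of the tree `t`, where `S`
contains the root and contains the parent of each of its vertices. The connected components of the
complement of `S` are then the branches at those `v ∉ S` whose parent is in `S`. -/
noncomputable def PlaneTree.remainder {t : PlaneTree} (S : Finset (Vert t)) : ForestSpace :=
  ∏ v ∈ Finset.univ.filter (fun v => v ∉ S ∧ ∃ u ∈ S, IsChild u v),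
    MvPolynomial.X (RTree.mk (branch v))

/-- The pruning `t ∖ t'`, the formal sum of the forests that remain. -/
noncomputable def PlaneTree.prune (t t' : PlaneTree) : ForestSpace :=
  ∑ S ∈ copies t' t, remainder S

theorem PlaneTree.remainder_map {p q : PlaneTree} (e : Iso p q) (S : Finset (Vert p)) :
    remainder (S.map e.toEquiv.toEmbedding) = remainder S := by
  classical
  symm
  refine Finset.prod_equiv e.toEquiv (fun v => ?_) (fun v _ => ?_)
  · simp only [Finset.mem_filter, Finset.mem_univ, true_and, Finset.mem_map_equiv,
      Equiv.symm_apply_apply]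
    refine and_congr_right fun _ => ?_
    rw [← e.toEquiv.exists_congr_right]
    simp [← e.map_child]
  · rw [RTree.mk_eq_iff.2 (Iso.branch v e)]

theorem PlaneTree.map_mem_copies {p q p' q' : PlaneTree} (e : Iso p q) (e' : Iso p' q')
    {S : Finset (Vert p)} (h : S ∈ copies p' p) :
    S.map e.toEquiv.toEmbedding ∈ copies q' q := by
  classical
  simp only [copies, Finset.mem_filter, Finset.mem_univ, true_and] at h ⊢
  obtain ⟨π, ⟨h1, h2, h3⟩, rfl⟩ := h
  refine ⟨e.toEquiv ∘ π ∘ e'.symm.toEquiv,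
    ⟨e.toEquiv.injective.comp (h1.comp e'.symm.toEquiv.injective), ?_, fun u v h => ?_⟩, ?_⟩
  · simp [e'.symm.map_root, h2, e.map_root]
  · exact (e.map_child _ _).1 (h3 _ _ ((e'.symm.map_child _ _).1 h))
  · ext v
    simp only [Finset.mem_map, Finset.mem_image, Finset.mem_univ, true_and,
      exists_exists_eq_and, Function.comp_apply, Equiv.coe_toEmbedding]
    exact e'.toEquiv.exists_congr fun a => by
      change _ ↔ e.toEquiv (π (e'.toEquiv.symm (e'.toEquiv a))) = v
      rw [Equiv.symm_apply_apply]

theorem PlaneTree.prune_congr (p p' q q' : PlaneTree) (h : p ≈ q) (h' : p' ≈ q') :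
    p.prune p' = q.prune q' := by
  obtain ⟨e⟩ := h
  obtain ⟨e'⟩ := h'
  refine Finset.sum_equiv e.toEquiv.finsetCongr (fun S => ⟨map_mem_copies e e', fun h => ?_⟩)
    (fun S _ => (remainder_map e S).symm)
  have := map_mem_copies e.symm e'.symm h
  convert this
  ext v
  simp [Iso.symm]

/-- The pruning `t ∖ t'`: the sum, over the ways in which `t` can be pruned to form `t'`, of the
forest that is cut off. -/
noncomputable def RTree.prune (t t' : RTree) : ForestSpace :=
  Quotient.lift₂ PlaneTree.prune PlaneTree.prune_congr t t'

/-! ### Coefficient maps -/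

/-- The space `B*` of all maps `{∅} ∪ T → ℝ`; `none` stands for `∅`. -/
abbrev BStar : Type := Option RTree → ℝ

/-- The affine subspace `B` of the maps with `a(∅) = 1`. -/
def B : Set BStar := {a | a none = 1}

/-- The (unique) extension of `a` to an algebra homomorphism on the forest space. -/
noncomputable def BStar.extend (a : BStar) : ForestSpace →ₐ[ℝ] ℝ :=
  MvPolynomial.aeval fun t => a (some t)

/-! ### Elementary differentials and B-series -/

section

variable {E : Type*} [NormedAddCommGroup E] [NormedSpace ℝ E]

/-- The elementary differentials, `F([t₁ ⋯ tₙ])(y) = f⁽ⁿ⁾(y) (F(t₁)(y), …, F(tₙ)(y))`; the one-vertex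
tree is the case `n = 0`. -/
noncomputable def PlaneTree.elemDiff (f : E → E) : PlaneTree → E → E
  | node n c, y => iteratedFDeriv ℝ n f y fun i => (c i).elemDiff f y

/-- The elementary differential `F(t) : E → E` of a rooted tree, computed with some ordering of the
branches. For smooth `f` the ordering does not matter, see `RTree.elemDiff_mk`. -/
noncomputable def RTree.elemDiff (f : E → E) (t : RTree) : E → E :=
  (Quotient.out t).elemDiff f

theorem iteratedFDeriv_swap {f : E → E} (hf : ContDiff ℝ (⊤ : ℕ∞) f) :
    (n : ℕ) → (i : Fin n) → (y : E) → (v : Fin (n + 1) → E) →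
    iteratedFDeriv ℝ (n + 1) f y (v ∘ Equiv.swap i.castSucc i.succ) =
      iteratedFDeriv ℝ (n + 1) f y v := by
  have hd : ∀ n : ℕ, ContDiff ℝ (⊤ : ℕ∞) (iteratedFDeriv ℝ n f) := fun n =>
    hf.iteratedFDeriv_right (m := ((⊤ : ℕ∞) : WithTop ℕ∞)) (by exact_mod_cast le_top)
  have hdd : ∀ (n : ℕ) y, DifferentiableAt ℝ (iteratedFDeriv ℝ n f) y := fun n y =>
    (hd n).contDiffAt.differentiableAt (by simp)
  intro n
  induction n with
  | zero => exact fun i => i.elim0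
  | succ n ih =>
    intro i y v
    cases i using Fin.cases with
    | zero =>
      have key : ∀ w : Fin (n + 2) → E, iteratedFDeriv ℝ (n + 2) f y w =
          fderiv ℝ (fderiv ℝ (iteratedFDeriv ℝ n f)) y (w 0) (w 1)
            (Fin.tail (Fin.tail w)) := by
        intro w
        rw [(hdd _ y).iteratedFDeriv_succ_apply_left']
        have h2 : DifferentiableAt ℝ (fderiv ℝ (iteratedFDeriv ℝ n f)) y :=
          ((hd n).fderiv_right (m := ((⊤ : ℕ∞) : WithTop ℕ∞)) (by simp)).contDiffAt.differentiableAt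
            (by simp)
        have : (fun z => iteratedFDeriv ℝ (n + 1) f z (Fin.tail w)) =
            fun z => (ContinuousMultilinearMap.apply ℝ (fun _ : Fin n => E) E
              (Fin.tail (Fin.tail w))) (fderiv ℝ (iteratedFDeriv ℝ n f) z (w 1)) := rfl
        rw [this]
        have h3 := (ContinuousMultilinearMap.apply ℝ (fun _ : Fin n => E) E
              (Fin.tail (Fin.tail w))).hasFDerivAt.comp y (h2.hasFDerivAt.clm_apply
                (hasFDerivAt_const (w 1) y))
        have h4 := h3.fderiv
        simp only [Function.comp_def] at h4
        rw [h4]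
        simp
      rw [key, key]
      have hs : IsSymmSndFDerivAt ℝ (iteratedFDeriv ℝ n f) y :=
        (hd n).contDiffAt.isSymmSndFDerivAt
          (by rw [minSmoothness_of_isRCLikeNormedField]; exact WithTop.coe_le_coe.2 (le_top : (2 : ℕ∞) ≤ ⊤))
      have ht : Fin.tail (Fin.tail (v ∘ Equiv.swap (Fin.castSucc 0) (Fin.succ 0))) =
          Fin.tail (Fin.tail v) := by
        funext j
        simp only [Fin.tail, Function.comp_apply]
        congr 1
      rw [ht, hs.eq]
      simp
    | succ i =>
      rw [(hdd _ y).iteratedFDeriv_succ_apply_left', (hdd _ y).iteratedFDeriv_succ_apply_left']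
      have h0 : (v ∘ Equiv.swap i.succ.castSucc i.succ.succ) 0 = v 0 := by
        simp only [Function.comp_apply]
        congr 1
      have ht : Fin.tail (v ∘ Equiv.swap i.succ.castSucc i.succ.succ) =
          Fin.tail v ∘ Equiv.swap i.castSucc i.succ := by
        funext j
        simp only [Fin.tail, Function.comp_apply]
        congr 1
        rw [← Fin.succ_castSucc]
        exact ((Fin.succ_injective _).map_swap _ _ _).symm
      simp only [h0, ht, ih]

theorem iteratedFDeriv_perm {f : E → E} (hf : ContDiff ℝ (⊤ : ℕ∞) f) (y : E) :
    (n : ℕ) → (σ : Equiv.Perm (Fin n)) → (v : Fin n → E) →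
    iteratedFDeriv ℝ n f y (v ∘ σ) = iteratedFDeriv ℝ n f y v
  | 0, σ, v => by congr 1; exact Subsingleton.elim _ _
  | n + 1, σ, v => by
    have hσ : σ ∈ Submonoid.closure
        (Set.range fun i : Fin n => Equiv.swap i.castSucc i.succ) := by
      rw [Equiv.Perm.mclosure_swap_castSucc_succ]; trivial
    induction hσ using Submonoid.closure_induction generalizing v with
    | mem σ h =>
      obtain ⟨i, rfl⟩ := h
      exact iteratedFDeriv_swap hf n i y v
    | one => rfl
    | mul σ τ _ _ h1 h2 =>
      rw [Equiv.Perm.coe_mul, ← Function.comp_assoc, h2, h1]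

theorem PlaneTree.elemDiff_congr {f : E → E} (hf : ContDiff ℝ (⊤ : ℕ∞) f) (y : E) :
    (p q : PlaneTree) → Nonempty (Iso p q) → p.elemDiff f y = q.elemDiff f y
  | node n c, node m d, ⟨e⟩ => by
    obtain ⟨g, hg⟩ := e.exists_equiv
    obtain rfl : n = m := by simpa using Fintype.card_congr g
    have := fun i => elemDiff_congr hf y _ _ (hg i)
    simp only [elemDiff, this]
    exact iteratedFDeriv_perm hf y n g fun i => (d i).elemDiff f y

theorem RTree.elemDiff_mk {f : E → E} (hf : ContDiff ℝ (⊤ : ℕ∞) f) (p : PlaneTree) :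
    (RTree.mk p).elemDiff f = p.elemDiff f :=
  funext fun y => PlaneTree.elemDiff_congr hf y _ _
    (RTree.mk_eq_iff.1 (Quotient.out_eq (RTree.mk p)))

/-- Formal power series `∑ hⁿ Yₙ` in `h` with coefficients in `E`. -/
abbrev FormalSeries (E : Type*) : Type _ := ℕ → E

/-- The formal power series `g(Y)` for a smooth map `g` and `Y = Y₀ + δ`, `δ = ∑_{k ≥ 1} hᵏ Yₖ`,
given by the Taylor expansion `∑ₘ (1 / m!) g⁽ᵐ⁾(Y₀)(δ, …, δ)`: the coefficient of `hⁿ` is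
the sum of `(1 / m!) g⁽ᵐ⁾(Y₀)(Y_{k₁}, …, Y_{kₘ})` over all `m` and all `k₁, …, kₘ ≥ 1` with
`k₁ + ⋯ + kₘ = n`. -/
noncomputable def formalEval (g : E → E) (Y : FormalSeries E) : FormalSeries E := fun n =>
  ∑ k : Composition n,
    (k.length.factorial : ℝ)⁻¹ • iteratedFDeriv ℝ k.length g (Y 0) fun i => Y (k.blocksFun i)

/-- The B-series `a(∅) y₀ + ∑ₜ h^|t| (a(t) / σ(t)) F(t)(y₀)` at a point `y₀`. -/
noncomputable def bSeries (f : E → E) (y₀ : E) (a : BStar) : FormalSeries E := fun n =>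
  (if n = 0 then a none • y₀ else 0) +
    ∑ t ∈ treesOfOrder n, (a (some t) / t.symmetry) • t.elemDiff f y₀

/-- The B-series `a(∅) Y + ∑ₜ h^|t| (a(t) / σ(t)) F(t)(Y)` at a formal series `Y`. -/
noncomputable def bSeriesAt (f : E → E) (Y : FormalSeries E) (a : BStar) : FormalSeries E :=
  fun n => a none • Y n +
    ∑ k ∈ Finset.HasAntidiagonal.antidiagonal n,
      ∑ t ∈ treesOfOrder k.1, (a (some t) / t.symmetry) • formalEval (t.elemDiff f) Y k.2

theorem formalEval_const (g : E → E) (y₀ : E) (n : ℕ) :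
    formalEval g (fun k => if k = 0 then y₀ else 0) n = if n = 0 then g y₀ else 0 := by
  rcases Nat.eq_zero_or_pos n with rfl | hn
  · have hl : ∀ k : Composition 0, k.length = 0 := fun k => Nat.le_zero.1 k.length_le
    have h1 : ∀ m : ℕ, m = 0 → ∀ v : Fin m → E,
        (m.factorial : ℝ)⁻¹ • iteratedFDeriv ℝ m g y₀ v = g y₀ := by
      rintro _ rfl v
      simp
    simp only [formalEval, if_true, h1 _ (hl _)]
    simp [composition_card]
  · rw [if_neg hn.ne']
    refine Finset.sum_eq_zero fun k _ => ?_
    rw [ContinuousMultilinearMap.map_coord_zero _ ⟨0, k.length_pos_of_pos hn⟩, smul_zero]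
    exact if_neg (Nat.one_le_iff_ne_zero.1 (k.one_le_blocksFun _))

/-- At a constant formal series the two notions agree. -/
theorem bSeriesAt_const (f : E → E) (y₀ : E) (a : BStar) :
    bSeriesAt f (fun k => if k = 0 then y₀ else 0) a = bSeries f y₀ a := by
  funext n
  simp only [bSeriesAt, bSeries, formalEval_const]
  congr 1
  · split_ifs <;> simp
  · rw [Finset.sum_eq_single (n, 0)]
    · simp
    · rintro ⟨i, j⟩ hij hne
      have : j ≠ 0 := by
        rintro rfl
        simp at hij
        simp [hij] at hne
      simp [this]
    · simp

end

end BSeries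

namespace BSeries

open PlaneTree

/-! ### Embeddings of plane trees, branch by branch -/

namespace PlaneTree

/-! Two normalisations remove the symmetry factors. A class `t` is replaced by its plane
representatives: with `w(p) = ∏ᵥ kᵥ!`, the sum of `1 / w(p)` over the representatives of `t` is `1 /
σ(t)` (`sum_reps_weight`). Copies of `t'` are replaced by embeddings: each copy is the image of
exactly `σ(t')` of them, so the sum `A(p', p)` of the values of `a` on the forests left by the
embeddings of `p'` in `p` is `σ(p') a(p ∖ p')` (`embeddingSum_eq`).

The core is `elemDiff_eqMod`: with `Y = y₀ + ∑ₚ h^|p| a(p) / w(p) F(p)(y₀)`, one has `h^|p'|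
F(p')(Y) = ∑ₚ h^|p| A(p', p) / w(p) F(p)(y₀)` modulo `O(h^(N+1))`. It goes by induction on `p'`. If
the root of `p'` has `m` branches, Taylor expansion of `f⁽ᵐ⁾` yields terms `(1 / k!) f⁽ᵐ⁺ᵏ⁾(y₀)`
with `k` arguments `Y - y₀` and `m` arguments known by induction. As the derivative is symmetric,
such a term is `1 / (m+k)!` times the sum over all placements of the `m` arguments among the `m+k`
slots. Multilinear expansion then gives trees with `m+k` branches; a placement says which branches
receive the branches of `p'`, and the other branches are cut off whole. This is the recursion for
`A` (`embeddingSum_node`).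

Only truncated sums are used, so smoothness of `f` suffices. `formalEval_eqMod` matches the formal
Taylor expansion with the actual one, and uniqueness of coefficients (`coeff_eq_of_eqMod`) brings
the result back to formal series. Summation against `b` finishes the proof. -/

theorem inBranch_injective {n : ℕ} {c : Fin n → PlaneTree} (i : Fin n) :
    Function.Injective (Vert.inBranch (c := c) i) := by
  intro u v h
  cases h
  rfl

/-- A vertex is the root or lies in one of the branches at the root. -/
def vertEquiv (n : ℕ) (c : Fin n → PlaneTree) :
    Vert (node n c) ≃ Option (Σ i : Fin n, Vert (c i)) where
  toFun v := match v with
    | .root _ => none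
    | .inBranch i v => some ⟨i, v⟩
  invFun o := match o with
    | none => .root _
    | some ⟨i, v⟩ => .inBranch i v
  left_inv v := by cases v <;> rfl
  right_inv o := by rcases o with _ | ⟨i, v⟩ <;> rfl

theorem prod_vert_node {M : Type*} [CommMonoid M] {n : ℕ} {c : Fin n → PlaneTree}
    (g : Vert (node n c) → M) :
    ∏ v, g v = g (.root _) * ∏ i, ∏ v : Vert (c i), g (.inBranch i v) := by
  rw [← (vertEquiv n c).symm.prod_comp, Fintype.prod_option, Fintype.prod_sigma]
  rfl

theorem not_isChild_root {t : PlaneTree} (u : Vert t) : ¬ IsChild u (.root t) := by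
  intro h
  cases h

theorem exists_parent : {t : PlaneTree} → (v : Vert t) → v ≠ .root t → ∃ u, IsChild u v
  | _, .root _, h => (h rfl).elim
  | _, .inBranch i v, _ => by
    by_cases hv : v = .root _
    · subst hv
      exact ⟨_, .root i⟩
    · obtain ⟨u, hu⟩ := exists_parent v hv
      exact ⟨_, hu.step i⟩

theorem IsChild.unique {t : PlaneTree} {u u' v : Vert t} (h : IsChild u v)
    (h' : IsChild u' v) : u = u' := by
  induction h with
  | root i =>
    generalize hz : Vert.root _ = z at h'
    cases h' with
    | root => rfl
    | step _ h' => subst hz; exact (not_isChild_root _ h').elim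
  | step i h ih =>
    cases h' with
    | root => exact (not_isChild_root _ h).elim
    | step _ h' => rw [ih h']

noncomputable instance (p' p : PlaneTree) : Fintype (embeddings p' p) := Fintype.ofFinite _

/-- Embeddings reflect edges. -/
theorem isChild_of_embedding {p' p : PlaneTree} {π : Vert p' → Vert p}
    (hπ : π ∈ embeddings p' p) {u v : Vert p'} (h : IsChild (π u) (π v)) : IsChild u v := by
  have hv : v ≠ .root _ := by
    rintro rfl
    rw [hπ.2.1] at h
    exact not_isChild_root _ h
  obtain ⟨u', hu'⟩ := exists_parent v hv
  rwa [hπ.1 (h.unique (hπ.2.2 _ _ hu'))]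

/-- A family of embeddings of the branches of a tree into distinct branches of another tree gives a
map between the vertices of the two trees. -/
def joinEmbeddings {m n : ℕ} {c : Fin m → PlaneTree} {d : Fin n → PlaneTree}
    (x : Σ ι : Fin m ↪ Fin n, ∀ i, embeddings (c i) (d (ι i))) :
    Vert (node m c) → Vert (node n d)
  | .root _ => .root _
  | .inBranch i v => .inBranch (x.1 i) ((x.2 i).1 v)

theorem joinEmbeddings_mem {m n : ℕ} {c : Fin m → PlaneTree} {d : Fin n → PlaneTree}
    (x : Σ ι : Fin m ↪ Fin n, ∀ i, embeddings (c i) (d (ι i))) :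
    joinEmbeddings x ∈ embeddings (node m c) (node n d) := by
  refine ⟨?_, rfl, ?_⟩
  · intro u v h
    cases u with
    | root =>
      cases v with
      | root => rfl
      | inBranch => cases h
    | inBranch i u =>
      cases v with
      | root => cases h
      | inBranch j v =>
        simp only [joinEmbeddings] at h
        have hij : i = j := by
          injection h with _ _ h
          exact x.1.injective h
        subst hij
        rw [(x.2 i).2.1 (inBranch_injective _ h)]
  · intro u v h
    cases h with
    | root i =>
      simp only [joinEmbeddings, (x.2 i).2.2.1]
      exact .root _
    | step i h => exact ((x.2 i).2.2.2 _ _ h).step _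

theorem joinEmbeddings_injective {m n : ℕ} {c : Fin m → PlaneTree} {d : Fin n → PlaneTree} :
    Function.Injective (joinEmbeddings (c := c) (d := d)) := by
  rintro ⟨ι, ρ⟩ ⟨ι', ρ'⟩ h
  obtain rfl : ι = ι' := by
    ext i
    have := congrFun h (.inBranch i (.root _))
    simp only [joinEmbeddings] at this
    injection this with _ _ this
    rw [this]
  congr
  funext i
  ext v
  exact inBranch_injective _ (congrFun h (.inBranch i v))

/-- Children of the root go to children of the root, which fixes a target branch for each branch.
Descendants stay in that branch, by induction along a path from its root. -/
theorem exists_joinEmbeddings {m n : ℕ} {c : Fin m → PlaneTree} {d : Fin n → PlaneTree}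
    {π : Vert (node m c) → Vert (node n d)} (hπ : π ∈ embeddings (node m c) (node n d)) :
    ∃ x, joinEmbeddings x = π := by
  have hroot : ∀ i, ∃ j, π (.inBranch i (.root _)) = .inBranch j (.root _) := fun i => by
    have := hπ.2.2 _ _ (IsChild.root i)
    rw [hπ.2.1] at this
    generalize π _ = z at this
    cases this
    exact ⟨_, rfl⟩
  choose ι hι using hroot
  have hbranch : ∀ i (v : Vert (c i)), ∃ w : Vert (d (ι i)),
      π (.inBranch i v) = .inBranch (ι i) w := fun i v => by
    induction reach v with
    | refl => exact ⟨_, hι i⟩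
    | tail _ hc ih =>
      obtain ⟨w, hw⟩ := ih
      have := hπ.2.2 _ _ (IsChild.step (c := c) i hc)
      rw [hw] at this
      generalize π _ = z at this
      cases this
      exact ⟨_, rfl⟩
  choose ρ hρ using hbranch
  have hinj : Function.Injective ι := fun i j h => by
    have : π (.inBranch i (.root _)) = π (.inBranch j (.root _)) := by rw [hι, hι, h]
    have := hπ.1 this
    injection this
  refine ⟨⟨⟨ι, hinj⟩, fun i => ⟨ρ i, ?_, ?_, ?_⟩⟩, ?_⟩
  · intro u v h
    refine inBranch_injective i (hπ.1 ?_)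
    rw [hρ, hρ, h]
  · refine inBranch_injective (ι i) ?_
    rw [← hρ, hι]
    rfl
  · intro u v h
    have := hπ.2.2 _ _ (IsChild.step (c := c) i h)
    rw [hρ, hρ] at this
    exact isChild_inBranch.1 this
  · funext v
    cases v with
    | root => exact hπ.2.1.symm
    | inBranch i v => exact (hρ i v).symm

/-- An embedding of a tree amounts to an embedding of the set of its branches together with an
embedding of each branch. -/
noncomputable def embeddingsNodeEquiv {m n : ℕ} (c : Fin m → PlaneTree) (d : Fin n → PlaneTree) :
    (Σ ι : Fin m ↪ Fin n, ∀ i, embeddings (c i) (d (ι i))) ≃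
      embeddings (node m c) (node n d) :=
  Equiv.ofBijective (fun x => ⟨joinEmbeddings x, joinEmbeddings_mem x⟩)
    ⟨fun _ _ h => joinEmbeddings_injective (congrArg Subtype.val h), fun ⟨_, hπ⟩ =>
      (exists_joinEmbeddings hπ).imp fun _ h => Subtype.ext h⟩

/-! ### Isomorphisms as embeddings -/

theorem Iso.mem_embeddings {p q : PlaneTree} (e : Iso p q) : ⇑e.toEquiv ∈ embeddings p q :=
  ⟨e.toEquiv.injective, e.map_root, fun u v => (e.map_child u v).1⟩

/-- Equal orders make an embedding bijective, and embeddings reflect edges. -/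
theorem nonempty_iso_of_embedding {p q : PlaneTree} (h : q.order = p.order)
    (hπ : (embeddings p q).Nonempty) : Nonempty (Iso p q) := by
  obtain ⟨π, hπ⟩ := hπ
  have hb : Function.Bijective π := (Fintype.bijective_iff_injective_and_card π).2 ⟨hπ.1, h.symm⟩
  exact ⟨⟨Equiv.ofBijective π hb, hπ.2.1, fun u v => ⟨hπ.2.2 u v, isChild_of_embedding hπ⟩⟩⟩

theorem order_le_of_embedding {p q : PlaneTree} (hπ : (embeddings p q).Nonempty) :
    p.order ≤ q.order := by
  obtain ⟨π, hπ⟩ := hπ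
  exact Fintype.card_le_of_injective π hπ.1

theorem order_eq_of_iso {p q : PlaneTree} (e : Nonempty (Iso p q)) : p.order = q.order :=
  e.elim fun e => Fintype.card_congr e.toEquiv

theorem embeddings_comp {p q r : PlaneTree} {π : Vert q → Vert r} {ρ : Vert p → Vert q}
    (hπ : π ∈ embeddings q r) (hρ : ρ ∈ embeddings p q) : π ∘ ρ ∈ embeddings p r :=
  ⟨hπ.1.comp hρ.1, by simp [hρ.2.1, hπ.2.1], fun _ _ h => hπ.2.2 _ _ (hρ.2.2 _ _ h)⟩

theorem card_embeddings_congr {p q : PlaneTree} (e : Iso p q) :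
    Fintype.card (embeddings p q) = Fintype.card (embeddings p p) := by
  refine Fintype.card_congr
    ⟨fun π => ⟨e.symm.toEquiv ∘ π.1, embeddings_comp e.symm.mem_embeddings π.2⟩,
      fun π => ⟨e.toEquiv ∘ π.1, embeddings_comp e.mem_embeddings π.2⟩, fun π => ?_, fun π => ?_⟩
  · ext v
    exact e.toEquiv.apply_symm_apply _
  · ext v
    exact e.toEquiv.symm_apply_apply _

theorem mk_node_eq_of_perm {n : ℕ} {c d : Fin n → PlaneTree} (g : Equiv.Perm (Fin n))
    (h : ∀ i, RTree.mk (c i) = RTree.mk (d (g i))) :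
    RTree.mk (node n c) = RTree.mk (node n d) := by
  have h' := fun i => RTree.mk_eq_iff.1 (h i)
  refine RTree.mk_eq_iff.2 (nonempty_iso_of_embedding ?_
    ⟨_, joinEmbeddings_mem ⟨g.toEmbedding, fun i => ⟨_, (h' i).some.mem_embeddings⟩⟩⟩)
  rw [order_node, order_node, ← Equiv.sum_comp g]
  simp only [order_eq_of_iso (h' _)]

/-- The stabiliser of `f` is a product of symmetric groups on its fibres. With `f` the classes of
the branches, this is the factorial part of `σ`. -/
theorem card_perm_comp_eq {α : Type*} {n : ℕ} [DecidableEq α] (f : Fin n → α) :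
    (Finset.univ.filter fun g : Equiv.Perm (Fin n) => f ∘ g = f).card =
      ∏ x ∈ Finset.univ.image f, (Finset.univ.filter fun i => f i = x).card.factorial := by
  rw [← Fintype.card_subtype, DomMulAct.stabilizer_card']
  simp only [Fintype.card_subtype]

/-- The symmetry of a tree is the number of its automorphisms. -/
theorem card_embeddings_self : (p : PlaneTree) → Fintype.card (embeddings p p) = p.symmetry
  | node n c => by
    classical
    -- A self-embedding permutes the branches at the root by some `g`; only those `g` that preserve
    -- isomorphism classes contribute.
    have hcard : ∀ g : Equiv.Perm (Fin n),
        ∏ i, Fintype.card (embeddings (c i) (c (g i))) =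
          if (fun i => RTree.mk (c i)) ∘ g = (fun i => RTree.mk (c i))
            then ∏ i, (c i).symmetry else 0 := fun g => by
      split_ifs with h
      · refine Finset.prod_congr rfl fun i _ => ?_
        obtain ⟨e⟩ := RTree.mk_eq_iff.1 (congrFun h i).symm
        rw [← card_embeddings_self (c i)]
        exact card_embeddings_congr e
      -- Each branch `c i` would embed in `c (g i)`, so orders could only grow. Their total is
      -- invariant under `g`, hence all orders agree and the embeddings are isomorphisms.
      · by_contra h0
        have hne : ∀ i, (embeddings (c i) (c (g i))).Nonempty := fun i => by
          have := Finset.prod_ne_zero_iff.1 h0 i (Finset.mem_univ i)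
          exact Set.nonempty_coe_sort.1 (Fintype.card_pos_iff.1 (Nat.pos_of_ne_zero this))
        have hle := fun i => order_le_of_embedding (hne i)
        have hsum : ∑ i, (c i).order = ∑ i, (c (g i)).order :=
          (Equiv.sum_comp g fun i => (c i).order).symm
        have heq := (Finset.sum_eq_sum_iff_of_le fun i _ => hle i).1 hsum
        refine h (funext fun i => (RTree.mk_eq_iff.2 ?_).symm)
        exact nonempty_iso_of_embedding (heq i (Finset.mem_univ i)).symm (hne i)
    have hsigma := Fintype.card_congr (embeddingsNodeEquiv c c).symm
    rw [Fintype.card_sigma] at hsigma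
    simp only [Fintype.card_pi] at hsigma
    rw [hsigma, ← (Equiv.embeddingEquivOfFinite (Fin n)).symm.sum_comp]
    rw [symmetry, ← card_perm_comp_eq, mul_comm, ← smul_eq_mul, ← Finset.sum_const,
      Finset.sum_filter]
    exact Finset.sum_congr rfl fun g _ => hcard g

end PlaneTree

/-! ### Forests left over by embeddings -/

namespace PlaneTree

/-- The sum over all embeddings of the forests that are left over. -/
noncomputable def embeddingSum (p' p : PlaneTree) : ForestSpace :=
  open Classical in ∑ π : embeddings p' p, remainder (Finset.univ.image π.1)

-- Relative to one embedding `π₀` with image `S`, every other one is `π₀ ∘ α` for a unique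
-- self-embedding `α` of `p'`, because `π₀` reflects edges.
open Classical in
theorem card_embeddings_image {p' p : PlaneTree} {S : Finset (Vert p)} (hS : S ∈ copies p' p) :
    (Finset.univ.filter fun π : embeddings p' p => Finset.univ.image π.1 = S).card =
      p'.symmetry := by
  simp only [copies, Finset.mem_filter, Finset.mem_univ, true_and] at hS
  obtain ⟨π₀, h₀, rfl⟩ := hS
  rw [← card_embeddings_self, ← Finset.card_univ]
  symm
  refine Finset.card_bij (fun α _ => ⟨π₀ ∘ α.1, embeddings_comp h₀ α.2⟩) ?_ ?_ ?_
  · intro α _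
    have hα : Function.Surjective α.1 := Finite.surjective_of_injective α.2.1
    simp only [Finset.mem_filter, Finset.mem_univ, true_and]
    rw [← Finset.image_image, Finset.image_univ_of_surjective hα]
  · intro α _ β _ h
    ext v
    exact h₀.1 (congrFun (congrArg Subtype.val h) v)
  · rintro ⟨π, hπ⟩ h
    simp only [Finset.mem_filter, Finset.mem_univ, true_and] at h
    have hex : ∀ v, ∃ w, π₀ w = π v := fun v => by
      have : π v ∈ Finset.univ.image π := Finset.mem_image_of_mem _ (Finset.mem_univ v)
      rw [h] at this
      simpa using this
    choose α hα using hex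
    refine ⟨⟨α, fun u v huv => hπ.1 ?_, h₀.1 ?_, fun u v huv => ?_⟩, Finset.mem_univ _,
      Subtype.ext (funext hα)⟩
    · rw [← hα, ← hα, huv]
    · rw [hα, hπ.2.1, h₀.2.1]
    · refine isChild_of_embedding h₀ ?_
      rw [hα, hα]
      exact hπ.2.2 _ _ huv

/-- Every copy of `p'` in `p` is the image of `σ(p')` embeddings. -/
theorem embeddingSum_eq (p' p : PlaneTree) :
    embeddingSum p' p = (p'.symmetry : ForestSpace) * p.prune p' := by
  classical
  rw [embeddingSum, prune, Finset.mul_sum,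
    ← Finset.sum_fiberwise_of_maps_to (t := copies p' p)
      (g := fun π : embeddings p' p => Finset.univ.image π.1)]
  · refine Finset.sum_congr rfl fun S hS => ?_
    rw [Finset.sum_congr rfl (g := fun _ => remainder S), Finset.sum_const,
      card_embeddings_image hS, nsmul_eq_mul]
    intro π hπ
    rw [(Finset.mem_filter.1 hπ).2]
  · intro π _
    simp only [copies, Finset.mem_filter, Finset.mem_univ, true_and]
    exact ⟨π.1, π.2, rfl⟩

open Classical in
theorem remainder_eq_prod {t : PlaneTree} (S : Finset (Vert t)) :
    remainder S = ∏ v, if v ∉ S ∧ ∃ u ∈ S, IsChild u v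
      then (MvPolynomial.X (RTree.mk (branch v)) : ForestSpace) else 1 := by
  rw [remainder, Finset.prod_filter]

-- A branch that is hit by the placement is pruned by its own embedding; a branch that is missed
-- hangs directly from the root and is cut off whole.
open Classical in
theorem remainder_joinEmbeddings {m n : ℕ} {c : Fin m → PlaneTree} {d : Fin n → PlaneTree}
    (x : Σ ι : Fin m ↪ Fin n, ∀ i, embeddings (c i) (d (ι i))) :
    remainder (Finset.univ.image (joinEmbeddings x)) =
      (∏ i, remainder (Finset.univ.image (x.2 i).1)) *
        ∏ j ∈ Finset.univ.filter (fun j => j ∉ Set.range x.1),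
          (MvPolynomial.X (RTree.mk (d j)) : ForestSpace) := by
  obtain ⟨ι, ρ⟩ := x
  have hmem : ∀ i w, Vert.inBranch (ι i) w ∈ Finset.univ.image (joinEmbeddings ⟨ι, ρ⟩) ↔
      w ∈ Finset.univ.image (ρ i).1 := by
    intro i w
    simp only [Finset.mem_image, Finset.mem_univ, true_and]
    constructor
    · rintro ⟨v, hv⟩
      cases v with
      | root => cases hv
      | inBranch i' v =>
        simp only [joinEmbeddings] at hv
        have hi : i' = i := by
          injection hv with _ _ h
          exact ι.injective h
        subst hi
        exact ⟨v, inBranch_injective _ hv⟩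
    · rintro ⟨v, rfl⟩
      exact ⟨.inBranch i v, rfl⟩
  have hnot : ∀ j, j ∉ Set.range ι → ∀ w,
      Vert.inBranch j w ∉ Finset.univ.image (joinEmbeddings ⟨ι, ρ⟩) := by
    intro j hj w
    simp only [Finset.mem_image, Finset.mem_univ, true_and]
    rintro ⟨v, hv⟩
    cases v with
    | root => cases hv
    | inBranch i v =>
      simp only [joinEmbeddings] at hv
      injection hv with _ _ h
      exact hj ⟨i, h⟩
  have hroot : Vert.root (node n d) ∈ Finset.univ.image (joinEmbeddings ⟨ι, ρ⟩) :=
    Finset.mem_image.2 ⟨.root _, Finset.mem_univ _, rfl⟩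
  set S := Finset.univ.image (joinEmbeddings ⟨ι, ρ⟩) with hS
  -- The parent of a branch root is the root of the whole tree, which always lies in `S`.
  have hboundary : ∀ j w, (∃ u ∈ S, IsChild u (Vert.inBranch (c := d) j w)) ↔
      w = .root _ ∨ ∃ u, Vert.inBranch j u ∈ S ∧ IsChild u w := by
    intro j w
    constructor
    · rintro ⟨u, hu, h⟩
      cases h with
      | root => exact .inl rfl
      | step _ h => exact .inr ⟨_, hu, h⟩
    · rintro (rfl | ⟨u, hu, h⟩)
      · exact ⟨_, hroot, .root j⟩
      · exact ⟨_, hu, .step j h⟩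
  rw [remainder_eq_prod, prod_vert_node, if_neg (by simp [hroot]), one_mul,
    ← Finset.prod_filter_mul_prod_filter_not Finset.univ (fun j => j ∈ Set.range ι)]
  congr 1
  · have him : (Finset.univ.filter fun j => j ∈ Set.range ι) = Finset.univ.map ι := by
      ext j
      simp
    rw [him, Finset.prod_map]
    refine Finset.prod_congr rfl fun i _ => ?_
    rw [remainder_eq_prod]
    refine Finset.prod_congr rfl fun w _ => ?_
    have hri : Vert.root (d (ι i)) ∈ Finset.univ.image (ρ i).1 :=
      Finset.mem_image.2 ⟨.root _, Finset.mem_univ _, (ρ i).2.2.1⟩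
    have hiff : (Vert.inBranch (ι i) w ∉ S ∧ ∃ u ∈ S, IsChild u (Vert.inBranch (ι i) w)) ↔
        (w ∉ Finset.univ.image (ρ i).1 ∧ ∃ u ∈ Finset.univ.image (ρ i).1, IsChild u w) := by
      rw [hboundary, hmem]
      refine and_congr_right fun hw => ?_
      simp only [hmem]
      refine ⟨fun h => h.resolve_left ?_, .inr⟩
      rintro rfl
      exact hw hri
    rw [if_congr hiff rfl rfl]
    rfl
  · refine Finset.prod_congr rfl fun j hj => ?_
    have hj' := hnot j (Finset.mem_filter.1 hj).2
    rw [Finset.prod_eq_single (Vert.root (d j))]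
    · rw [if_pos]
      · rfl
      · exact ⟨hj' _, (hboundary _ _).2 (.inl rfl)⟩
    · intro w _ hw
      rw [if_neg]
      rw [hboundary]
      rintro ⟨-, h | ⟨u, hu, -⟩⟩
      · exact hw h
      · exact hj' u hu
    · simp

/-- `Function.extend ι` encodes the placement: slot `ι i` carries datum `i`, and every free slot
carries the default `g'`. -/
theorem prod_extend {M : Type*} [CommMonoid M] {m n : ℕ} (ι : Fin m ↪ Fin n)
    (g : Fin m → Fin n → M) (g' : Fin n → M) :
    open Classical in
    ∏ j, Function.extend ι (fun i => g i) (fun _ => g') j j =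
      (∏ i, g i (ι i)) * ∏ j ∈ Finset.univ.filter (fun j => j ∉ Set.range ι), g' j := by
  classical
  have him : (Finset.univ.filter fun j => j ∈ Set.range ι) = Finset.univ.map ι := by
    ext j
    simp
  rw [← Finset.prod_filter_mul_prod_filter_not Finset.univ (fun j => j ∈ Set.range ι), him,
    Finset.prod_map]
  congr 1
  · exact Finset.prod_congr rfl fun i _ => by rw [ι.injective.extend_apply]
  · refine Finset.prod_congr rfl fun j hj => ?_
    rw [Function.extend_apply' _ _ _ (Finset.mem_filter.1 hj).2]

/-- For a fixed placement of the branches, their embeddings are chosen independently, so the sum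
factorises over the branches of the larger tree. This product over slots has the shape of a
multilinear expansion. -/
theorem embeddingSum_node {m n : ℕ} (c : Fin m → PlaneTree) (d : Fin n → PlaneTree) :
    embeddingSum (node m c) (node n d) = ∑ ι : Fin m ↪ Fin n,
      ∏ j, Function.extend ι (fun i j => embeddingSum (c i) (d j))
        (fun _ j => MvPolynomial.X (RTree.mk (d j))) j j := by
  classical
  rw [embeddingSum, ← (embeddingsNodeEquiv c d).sum_comp, Fintype.sum_sigma]
  refine Finset.sum_congr rfl fun ι _ => ?_
  rw [prod_extend ι (fun i j => embeddingSum (c i) (d j))]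
  simp only [embeddingSum]
  rw [Finset.prod_univ_sum, Fintype.piFinset_univ, Finset.sum_mul]
  exact Finset.sum_congr rfl fun ρ _ => remainder_joinEmbeddings ⟨ι, ρ⟩

/-! ### Sums over plane trees -/

/-- The number `∏ᵥ kᵥ!`, where `kᵥ` is the number of children of the vertex `v`. -/
noncomputable def weight : PlaneTree → ℕ
  | node n c => n.factorial * ∏ i, (c i).weight

theorem weight_pos : (p : PlaneTree) → 0 < p.weight
  | node n c => by
    rw [weight]
    exact Nat.mul_pos n.factorial_pos (Finset.prod_pos fun i _ => weight_pos (c i))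

theorem symmetry_pos : (p : PlaneTree) → 0 < p.symmetry
  | node n c => by
    rw [symmetry]
    exact Nat.mul_pos (Finset.prod_pos fun i _ => symmetry_pos (c i))
      (Finset.prod_pos fun _ _ => Nat.factorial_pos _)

/-- The plane trees of order at most `N`. -/
noncomputable def treesUpTo (N : ℕ) : Finset PlaneTree := (finite_order_le N).toFinset

theorem mem_treesUpTo {N : ℕ} {p : PlaneTree} : p ∈ treesUpTo N ↔ p.order ≤ N := by
  simp [treesUpTo]

end PlaneTree

theorem RTree.exists_mk (t : RTree) : ∃ p, RTree.mk p = t := Quotient.exists_rep t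

theorem RTree.order_mk (p : PlaneTree) : (RTree.mk p).order = p.order := rfl

theorem RTree.symmetry_mk (p : PlaneTree) : (RTree.mk p).symmetry = p.symmetry := rfl

theorem RTree.prune_mk (p p' : PlaneTree) : (RTree.mk p).prune (RTree.mk p') = p.prune p' := rfl

theorem mem_treesOfOrder {n : ℕ} {t : RTree} : t ∈ treesOfOrder n ↔ t.order = n := by
  simp [treesOfOrder]

/-- The plane trees that represent a rooted tree. -/
noncomputable def RTree.reps (t : RTree) : Finset PlaneTree :=
  open Classical in (treesUpTo t.order).filter fun p => RTree.mk p = t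

theorem RTree.mem_reps {t : RTree} {p : PlaneTree} : p ∈ t.reps ↔ RTree.mk p = t := by
  simp only [reps, Finset.mem_filter, mem_treesUpTo, and_iff_right_iff_imp]
  rintro rfl
  exact le_rfl

theorem PlaneTree.mk_node_eq_iff {n : ℕ} {c d : Fin n → PlaneTree} :
    RTree.mk (node n d) = RTree.mk (node n c) ↔
      ∃ g : Equiv.Perm (Fin n), ∀ i, RTree.mk (d i) = RTree.mk (c (g i)) := by
  refine ⟨fun h => ?_, fun ⟨g, h⟩ => mk_node_eq_of_perm g h⟩
  obtain ⟨e⟩ := RTree.mk_eq_iff.1 h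
  obtain ⟨g, hg⟩ := e.exists_equiv
  exact ⟨g, fun i => RTree.mk_eq_iff.2 (hg i)⟩

/-- The permutations carrying `f` to `f'` form a coset of the stabiliser of `f`. -/
theorem card_perm_comp_eq_of_exists {α : Type*} {n : ℕ} [DecidableEq α] {f f' : Fin n → α}
    (h : ∃ g : Equiv.Perm (Fin n), f' = f ∘ g) :
    (Finset.univ.filter fun g : Equiv.Perm (Fin n) => f' = f ∘ g).card =
      (Finset.univ.filter fun g : Equiv.Perm (Fin n) => f ∘ g = f).card := by
  obtain ⟨g₀, rfl⟩ := h
  refine Finset.card_equiv (Equiv.mulRight g₀⁻¹) fun g => ?_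
  simp only [Finset.mem_filter, Finset.mem_univ, true_and, Equiv.coe_mulRight,
    Equiv.Perm.coe_mul, ← Function.comp_assoc]
  constructor
  · intro h
    rw [← h, Function.comp_assoc, ← Equiv.Perm.coe_mul, mul_inv_cancel]
    rfl
  · intro h
    conv_lhs => rw [← h]
    rw [Function.comp_assoc, ← Equiv.Perm.coe_mul, inv_mul_cancel]
    rfl

/-- The product of the unions of representatives is only a finite set large enough to contain the
branches of every representative; the filter does the selection. -/
theorem sum_reps_node {n : ℕ} (c : Fin n → PlaneTree) (φ : PlaneTree → ℝ) :
    ∑ p ∈ (RTree.mk (node n c)).reps, φ p = open Classical in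
      ∑ d ∈ (Fintype.piFinset fun _ : Fin n => Finset.univ.biUnion fun i => (RTree.mk (c i)).reps)
        with RTree.mk (node n d) = RTree.mk (node n c), φ (node n d) := by
  classical
  symm
  refine Finset.sum_bij (fun d _ => node n d) ?_ ?_ ?_ fun _ _ => rfl
  · intro d hd
    exact RTree.mem_reps.2 (Finset.mem_filter.1 hd).2
  · intro d _ d' _ h
    injection h
  · rintro ⟨m, d⟩ hd
    rw [RTree.mem_reps] at hd
    obtain ⟨e⟩ := RTree.mk_eq_iff.1 hd
    obtain ⟨g, hg⟩ := e.exists_equiv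
    obtain rfl : m = n := by simpa using Fintype.card_congr g
    refine ⟨d, Finset.mem_filter.2 ⟨Fintype.mem_piFinset.2 fun i => ?_, hd⟩, rfl⟩
    exact Finset.mem_biUnion.2 ⟨g i, Finset.mem_univ _, RTree.mem_reps.2
      (RTree.mk_eq_iff.2 (hg i))⟩

/-- A rooted tree `t` has `∏ᵥ kᵥ! / σ(t)` plane representatives. -/
theorem sum_reps_weight : (p : PlaneTree) →
    ∑ q ∈ (RTree.mk p).reps, (q.weight : ℝ)⁻¹ = (p.symmetry : ℝ)⁻¹
  | node n c => by
    classical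
    set R := Finset.univ.biUnion fun i => (RTree.mk (c i)).reps with hR
    set f : Fin n → RTree := fun i => RTree.mk (c i) with hf
    set s := (Finset.univ.filter fun g : Equiv.Perm (Fin n) => f ∘ g = f).card with hs
    have hs0 : (s : ℝ) ≠ 0 := by
      refine Nat.cast_ne_zero.2 (Finset.card_pos.2 ⟨1, ?_⟩).ne'
      simp
    have hsym : (node n c).symmetry = (∏ i, (c i).symmetry) * s := by
      rw [symmetry, hs, card_perm_comp_eq]
    -- Once `g` is fixed, the entry `d i` ranges freely over the representatives of `c (g i)`, so
    -- the sum factorises and induction applies.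
    have hperm : ∀ g : Equiv.Perm (Fin n),
        ∑ d ∈ Fintype.piFinset fun _ : Fin n => R with (fun i => RTree.mk (d i)) = f ∘ g,
          ∏ i, ((d i).weight : ℝ)⁻¹ = ∏ i, ((c i).symmetry : ℝ)⁻¹ := fun g => by
      have : (Fintype.piFinset fun _ : Fin n => R).filter
          (fun d => (fun i => RTree.mk (d i)) = f ∘ g) =
          Fintype.piFinset fun i => (f (g i)).reps := by
        ext d
        simp only [Finset.mem_filter, Fintype.mem_piFinset, RTree.mem_reps, funext_iff,
          Function.comp_apply, and_iff_right_iff_imp, hR, Finset.mem_biUnion, Finset.mem_univ,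
          true_and]
        exact fun h i => ⟨g i, h i⟩
      rw [this, ← Finset.prod_univ_sum (fun i => (f (g i)).reps) fun _ q => (q.weight : ℝ)⁻¹,
        ← Equiv.prod_comp g fun i => ((c i).symmetry : ℝ)⁻¹]
      exact Finset.prod_congr rfl fun i _ => sum_reps_weight (c (g i))
    -- Double counting of pairs `(d, g)`: all `n!` permutations contribute equally by `hperm`, and
    -- each admissible `d` occurs for exactly `s` of them.
    have hcount : (n.factorial : ℝ) * ∏ i, ((c i).symmetry : ℝ)⁻¹ =
        ∑ d ∈ Fintype.piFinset fun _ : Fin n => R with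
          RTree.mk (node n d) = RTree.mk (node n c), (s : ℝ) * ∏ i, ((d i).weight : ℝ)⁻¹ := by
      have h1 : (n.factorial : ℝ) * ∏ i, ((c i).symmetry : ℝ)⁻¹ =
          ∑ _g : Equiv.Perm (Fin n), ∏ i, ((c i).symmetry : ℝ)⁻¹ := by
        rw [Finset.sum_const, Finset.card_univ, Fintype.card_perm, Fintype.card_fin, nsmul_eq_mul]
      rw [h1, Finset.sum_congr rfl fun g _ => (hperm g).symm]
      simp only [Finset.sum_filter]
      rw [Finset.sum_comm]
      refine Finset.sum_congr rfl fun d _ => ?_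
      rw [← Finset.sum_filter, Finset.sum_const, nsmul_eq_mul]
      have hiff : RTree.mk (node n d) = RTree.mk (node n c) ↔
          ∃ g : Equiv.Perm (Fin n), (fun i => RTree.mk (d i)) = f ∘ g := by
        simp only [mk_node_eq_iff, funext_iff, Function.comp_apply, hf]
      split_ifs with h
      · rw [card_perm_comp_eq_of_exists (hiff.1 h)]
      · rw [Finset.filter_false_of_mem]
        · simp
        · exact fun g _ hg => h (hiff.2 ⟨g, hg⟩)
    have hn : (n.factorial : ℝ) ≠ 0 := Nat.cast_ne_zero.2 n.factorial_ne_zero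
    rw [sum_reps_node, hsym]
    simp only [weight]
    push_cast
    simp only [mul_inv, Finset.prod_inv_distrib] at hcount ⊢
    rw [← Finset.mul_sum] at hcount ⊢
    field_simp
    field_simp at hcount
    linarith

/-- Sums over rooted trees, weighted by the inverse symmetry, as sums over plane trees. -/
theorem sum_treesOfOrder {E : Type*} [AddCommGroup E] [Module ℝ E] (n : ℕ) (φ : RTree → E) :
    ∑ t ∈ treesOfOrder n, (t.symmetry : ℝ)⁻¹ • φ t =
      ∑ p ∈ treesUpTo n with p.order = n, (p.weight : ℝ)⁻¹ • φ (RTree.mk p) := by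
  classical
  rw [← Finset.sum_fiberwise_of_maps_to (t := treesOfOrder n) (g := RTree.mk)]
  · refine Finset.sum_congr rfl fun t ht => ?_
    have hreps : ((treesUpTo n).filter fun p => p.order = n).filter (fun p => RTree.mk p = t) =
        t.reps := by
      ext p
      rw [mem_treesOfOrder] at ht
      simp only [Finset.mem_filter, mem_treesUpTo, RTree.mem_reps, and_iff_right_iff_imp]
      rintro rfl
      rw [RTree.order_mk] at ht
      omega
    rw [hreps]
    obtain ⟨q, rfl⟩ := t.exists_mk
    rw [RTree.symmetry_mk, ← sum_reps_weight, Finset.sum_smul]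
    exact Finset.sum_congr rfl fun p hp => by rw [RTree.mem_reps.1 hp]
  · intro p hp
    exact mem_treesOfOrder.2 (Finset.mem_filter.1 hp).2

/-! ### Taylor expansions up to a given order -/

/-- The tuple `(v, …, v, Z₀, …, Zₘ₋₁)` with `k` copies of `v`. -/
def prepend {α : Type*} {m : ℕ} (v : α) (Z : Fin m → α) : (k : ℕ) → Fin (m + k) → α
  | 0 => Z
  | k + 1 => Fin.cons (α := fun _ => α) v (prepend v Z k)

/-- The placement is chosen before `v` and `Z`, so that the same one serves for all values of `h`
later on. -/
theorem prepend_eq_extend (α : Type*) (m k : ℕ) :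
    ∃ ι : Fin m ↪ Fin (m + k), ∀ (v : α) (Z : Fin m → α),
      prepend v Z k = Function.extend ι Z fun _ => v := by
  induction k with
  | zero =>
    refine ⟨.refl _, fun v Z => funext fun i => ?_⟩
    exact (Function.Injective.extend_apply (f := id) Function.injective_id Z _ i).symm
  | succ k ih =>
    obtain ⟨ι, hι⟩ := ih
    refine ⟨ι.trans (Fin.succEmb _), fun v Z => funext fun j => ?_⟩
    rw [prepend, hι]
    refine Fin.cases ?_ (fun j => ?_) j
    · rw [Fin.cons_zero, Function.extend_apply']
      rintro ⟨i, hi⟩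
      exact Fin.succ_ne_zero _ hi
    · rw [Fin.cons_succ]
      by_cases hj : ∃ i, ι i = j
      · obtain ⟨i, rfl⟩ := hj
        rw [ι.injective.extend_apply]
        exact ((ι.trans (Fin.succEmb (m + k))).injective.extend_apply Z _ i).symm
      · rw [Function.extend_apply' _ _ _ hj, Function.extend_apply']
        rintro ⟨i, hi⟩
        exact hj ⟨i, Fin.succ_injective _ hi⟩

open Asymptotics Topology Filter

section

variable {E F : Type*} [NormedAddCommGroup E] [NormedAddCommGroup F]

/-- Two functions of `h` agree modulo `O(h ^ (N + 1))`. -/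
def EqMod (N : ℕ) (φ ψ : ℝ → E) : Prop :=
  (fun h => φ h - ψ h) =O[𝓝 0] fun h : ℝ => h ^ (N + 1)

namespace EqMod

variable {N : ℕ} {φ ψ χ φ' ψ' : ℝ → E}

theorem refl (φ : ℝ → E) : EqMod N φ φ := by
  simp only [EqMod, sub_self]
  exact isBigO_zero _ _

theorem symm (h : EqMod N φ ψ) : EqMod N ψ φ := by
  refine (IsBigO.neg_left h).congr_left fun x => ?_
  simp

theorem trans (h : EqMod N φ ψ) (h' : EqMod N ψ χ) : EqMod N φ χ :=
  (IsBigO.add h h').congr_left fun x => by simp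

theorem sum {ι : Type*} {s : Finset ι} {φ ψ : ι → ℝ → E} (h : ∀ i ∈ s, EqMod N (φ i) (ψ i)) :
    EqMod N (fun x => ∑ i ∈ s, φ i x) (fun x => ∑ i ∈ s, ψ i x) :=
  (IsBigO.fun_sum h).congr_left fun x => by simp

variable [NormedSpace ℝ E] [NormedSpace ℝ F]

theorem smul {c : ℝ → ℝ} (hc : ContinuousAt c 0) (h : EqMod N φ ψ) :
    EqMod N (fun x => c x • φ x) (fun x => c x • ψ x) := by
  have := (hc.isBigO_one ℝ).smul h
  refine (this.congr_left fun x => ?_).trans (isBigO_of_le _ fun x => ?_)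
  · exact smul_sub _ _ _
  · simp

/-- A difference of values of `M` is bounded by the difference of the arguments times a power of
their norms, which stays bounded near `0` by continuity. -/
theorem map_multilinear {n : ℕ} (M : ContinuousMultilinearMap ℝ (fun _ : Fin n => E) F)
    {φ ψ : ℝ → Fin n → E} (hφ : ContinuousAt φ 0) (hψ : ContinuousAt ψ 0)
    (h : ∀ i, EqMod N (fun x => φ x i) (fun x => ψ x i)) :
    EqMod N (fun x => M (φ x)) (fun x => M (ψ x)) := by
  have h' : (fun x => φ x - ψ x) =O[𝓝 0] fun x : ℝ => x ^ (N + 1) := isBigO_pi.2 h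
  have hmax : ContinuousAt (fun x => ‖M‖ * Fintype.card (Fin n) *
      max ‖φ x‖ ‖ψ x‖ ^ (Fintype.card (Fin n) - 1)) 0 :=
    continuousAt_const.mul ((hφ.norm.max hψ.norm).pow _)
  refine ((IsBigO.of_norm_le fun x => ?_).trans
    ((hmax.isBigO_one ℝ).mul h'.norm_left)).trans (isBigO_of_le _ fun x => ?_)
  · exact M.norm_image_sub_le _ _
  · simp

end EqMod

variable [NormedSpace ℝ E] [NormedSpace ℝ F]

theorem eqMod_pow_smul {N k : ℕ} (hk : N < k) (v : E) : EqMod N (fun h => h ^ k • v) 0 := by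
  simp only [EqMod, Pi.zero_apply, sub_zero]
  have h1 : (fun h : ℝ => h ^ k) =O[𝓝 0] fun h : ℝ => h ^ (N + 1) := by
    obtain ⟨l, rfl⟩ := Nat.exists_eq_add_of_lt hk
    have : ContinuousAt (fun h : ℝ => h ^ l) 0 := by fun_prop
    refine ((isBigO_refl (fun h : ℝ => h ^ (N + 1)) (𝓝 0)).mul (this.isBigO_one ℝ)).congr ?_ ?_
    · intro h
      ring
    · intro h
      simp
  have := h1.smul (isBigO_const_const v (one_ne_zero (α := ℝ)) (𝓝 (0 : ℝ)))
  exact this.congr_right fun x => by simp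

/-- The coefficients of an expansion are unique. -/
theorem coeff_eq_zero_of_eqMod {N : ℕ} {c : ℕ → E}
    (h : EqMod N (fun h => ∑ k ∈ Finset.range (N + 1), h ^ k • c k) 0) :
    ∀ k ≤ N, c k = 0 := by
  intro k
  induction k using Nat.strong_induction_on with
  | _ k ih =>
    intro hk
    -- The lower coefficients vanish by induction, so `x ^ k` factors out. Dividing by it for `x ≠
    -- 0` and letting `x → 0` isolates `c k`.
    have hsum : ∀ x : ℝ, ∑ j ∈ Finset.range (N + 1), x ^ j • c j =
        x ^ k • ∑ j ∈ Finset.range (N + 1 - k), x ^ j • c (k + j) := fun x => by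
      obtain ⟨l, hl⟩ := Nat.exists_eq_add_of_le (show k ≤ N + 1 by omega)
      rw [hl, Finset.sum_range_add, Finset.sum_eq_zero, zero_add, Finset.smul_sum,
        Nat.add_sub_cancel_left]
      · exact Finset.sum_congr rfl fun j _ => by rw [smul_smul, pow_add]
      · intro j hj
        rw [ih j (Finset.mem_range.1 hj) ((Finset.mem_range.1 hj).le.trans hk), smul_zero]
    simp only [EqMod, Pi.zero_apply, sub_zero, hsum] at h
    have h2 : Tendsto (fun x : ℝ => ∑ j ∈ Finset.range (N + 1 - k), x ^ j • c (k + j))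
        (𝓝[≠] 0) (𝓝 (c k)) := by
      have hc : Continuous fun x : ℝ =>
          ∑ j ∈ Finset.range (N + 1 - k), x ^ j • c (k + j) := by fun_prop
      have := hc.tendsto 0
      rw [Finset.sum_eq_single 0] at this
      · simp only [pow_zero, one_smul, add_zero] at this
        exact this.mono_left nhdsWithin_le_nhds
      · intro j _ hj
        simp [hj]
      · intro h
        exact (h (Finset.mem_range.2 (by omega))).elim
    have h3 : (fun x : ℝ => ∑ j ∈ Finset.range (N + 1 - k), x ^ j • c (k + j)) =O[𝓝[≠] 0]
        fun x : ℝ => x ^ (N + 1 - k) := by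
      have hinv : (fun x : ℝ => (x ^ k)⁻¹) =O[𝓝[≠] 0] fun x : ℝ => (x ^ k)⁻¹ := isBigO_refl _ _
      refine (hinv.smul (h.mono nhdsWithin_le_nhds)).congr' ?_ ?_
      · filter_upwards [self_mem_nhdsWithin] with x hx
        rw [smul_smul, inv_mul_cancel₀ (pow_ne_zero _ hx), one_smul]
      · filter_upwards [self_mem_nhdsWithin] with x hx
        rw [smul_eq_mul, pow_sub₀ _ hx (by omega), mul_comm]
    have h4 : Tendsto (fun x : ℝ => x ^ (N + 1 - k)) (𝓝[≠] 0) (𝓝 0) := by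
      have hc : Continuous fun x : ℝ => x ^ (N + 1 - k) := by fun_prop
      have := hc.tendsto 0
      rw [zero_pow (by omega)] at this
      exact this.mono_left nhdsWithin_le_nhds
    exact tendsto_nhds_unique h2 (h3.trans_tendsto h4)

theorem coeff_eq_of_eqMod {N : ℕ} {c c' : ℕ → E}
    (h : EqMod N (fun h => ∑ k ∈ Finset.range (N + 1), h ^ k • c k)
      (fun h => ∑ k ∈ Finset.range (N + 1), h ^ k • c' k)) {k : ℕ} (hk : k ≤ N) :
    c k = c' k := by
  refine sub_eq_zero.1 (coeff_eq_zero_of_eqMod (c := fun k => c k - c' k) (N := N) ?_ k hk)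
  simp only [EqMod, ← Finset.sum_sub_distrib, ← smul_sub] at h
  simpa only [EqMod, Pi.zero_apply, sub_zero] using h

theorem contDiff_iteratedFDeriv {f : E → F} (hf : ContDiff ℝ (⊤ : ℕ∞) f) (n : ℕ) :
    ContDiff ℝ (⊤ : ℕ∞) (iteratedFDeriv ℝ n f) :=
  hf.iteratedFDeriv_right (m := ((⊤ : ℕ∞) : WithTop ℕ∞)) (by exact_mod_cast le_top)

theorem differentiableAt_iteratedFDeriv {f : E → F} (hf : ContDiff ℝ (⊤ : ℕ∞) f) (n : ℕ) (y : E) :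
    DifferentiableAt ℝ (iteratedFDeriv ℝ n f) y :=
  (contDiff_iteratedFDeriv hf n).contDiffAt.differentiableAt (by simp)

/-- The remainder in integral form is controlled by a local bound on the continuous derivative of
order `N + 1`. -/
theorem taylor_isBigO [CompleteSpace F] {g : E → F} (hg : ContDiff ℝ (⊤ : ℕ∞) g) (y : E)
    (N : ℕ) :
    (fun v => g (y + v) - ∑ k ∈ Finset.range (N + 1),
      (k.factorial : ℝ)⁻¹ • iteratedFDeriv ℝ k g y fun _ => v) =O[𝓝 0]
        fun v => ‖v‖ ^ (N + 1) := by
  have hcont : Continuous fun z => ‖iteratedFDeriv ℝ (N + 1) g z‖ :=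
    (contDiff_iteratedFDeriv hg _).continuous.norm
  set C := ‖iteratedFDeriv ℝ (N + 1) g y‖ + 1 with hC
  obtain ⟨r, hr, hball⟩ := Metric.eventually_nhds_iff_ball.1
    (hcont.tendsto y |>.eventually (gt_mem_nhds (lt_add_one _)))
  refine IsBigO.of_bound ((N.factorial : ℝ)⁻¹ * C) ?_
  filter_upwards [Metric.ball_mem_nhds (0 : E) hr] with v hv
  rw [map_add_eq_sum_add_integral_iteratedFDeriv (n := N) (x := y) (y := v) (f := g)
    (fun t _ => hg.contDiffAt.of_le (by exact_mod_cast le_top)), add_sub_cancel_left, norm_smul,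
    norm_inv, Real.norm_natCast, mul_assoc, norm_pow, norm_norm]
  refine mul_le_mul_of_nonneg_left ?_ (by positivity)
  have := intervalIntegral.norm_integral_le_of_norm_le_const (a := 0) (b := 1)
    (f := fun t : ℝ => (1 - t) ^ N • iteratedFDeriv ℝ (N + 1) g (y + t • v) fun _ => v)
    (C := C * ‖v‖ ^ (N + 1)) fun t ht => ?_
  · simpa using this
  · rw [Set.uIoc_of_le zero_le_one] at ht
    have hmem : y + t • v ∈ Metric.ball y r := by
      rw [mem_ball_iff_norm, add_sub_cancel_left, norm_smul, Real.norm_eq_abs, abs_of_pos ht.1]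
      rw [mem_ball_zero_iff] at hv
      exact (mul_le_of_le_one_left (norm_nonneg _) ht.2).trans_lt hv
    have h1 : ‖(1 - t) ^ N‖ ≤ 1 := by
      rw [norm_pow, Real.norm_eq_abs, abs_of_nonneg (by linarith [ht.2])]
      exact pow_le_one₀ (by linarith [ht.2]) (by linarith [ht.1])
    have h2 := (iteratedFDeriv ℝ (N + 1) g (y + t • v)).le_opNorm fun _ => v
    rw [Finset.prod_const, Finset.card_univ, Fintype.card_fin] at h2
    rw [norm_smul]
    calc _ ≤ 1 * (‖iteratedFDeriv ℝ (N + 1) g (y + t • v)‖ * ‖v‖ ^ (N + 1)) :=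
          mul_le_mul h1 h2 (norm_nonneg _) zero_le_one
      _ ≤ _ := by
        rw [one_mul]
        exact mul_le_mul_of_nonneg_right (hball _ hmem).le (by positivity)

/-- `iteratedFDeriv` takes its newest direction first, as `prepend` does, and evaluation at the
fixed tuple `Z` is continuous linear, so it commutes with each further derivative. -/
theorem iteratedFDeriv_iteratedFDeriv_apply {f : E → F} (hf : ContDiff ℝ (⊤ : ℕ∞) f) (m k : ℕ)
    (y v : E) (Z : Fin m → E) :
    iteratedFDeriv ℝ k (iteratedFDeriv ℝ m f) y (fun _ => v) Z =
      iteratedFDeriv ℝ (m + k) f y (prepend v Z k) := by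
  induction k generalizing y with
  | zero => rfl
  | succ k ih =>
    have hg := contDiff_iteratedFDeriv hf m
    have h1 := (differentiableAt_iteratedFDeriv hf (m + k) y).iteratedFDeriv_succ_apply_left'
      (m := prepend v Z (k + 1))
    have h2 := (differentiableAt_iteratedFDeriv hg k y).iteratedFDeriv_succ_apply_left'
      (m := fun _ => v)
    refine Eq.trans ?_ h1.symm
    rw [h2]
    have h3 : Fin.tail (prepend v Z (k + 1)) = prepend v Z k := Fin.tail_cons (α := fun _ => E) _ _
    have h4 : prepend v Z (k + 1) 0 = v := rfl
    have h8 : (fun z => iteratedFDeriv ℝ (m.add k) f z (prepend v Z k)) =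
        fun z => iteratedFDeriv ℝ k (iteratedFDeriv ℝ m f) z (fun _ => v) Z :=
      funext fun z => (ih z).symm
    rw [h3, h4, h8]
    have h5 : DifferentiableAt ℝ (fun z => iteratedFDeriv ℝ k (iteratedFDeriv ℝ m f) z fun _ => v)
        y := (differentiableAt_iteratedFDeriv hg k y).continuousMultilinear_apply_const _
    have h6 : (fun z => iteratedFDeriv ℝ k (iteratedFDeriv ℝ m f) z (fun _ => v) Z) =
        fun z => ContinuousMultilinearMap.apply ℝ (fun _ : Fin m => E) F Z
          (iteratedFDeriv ℝ k (iteratedFDeriv ℝ m f) z fun _ => v) := rfl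
    rw [h6]
    have h7 := ((ContinuousMultilinearMap.apply ℝ (fun _ : Fin m => E) F Z).hasFDerivAt.comp y
      h5.hasFDerivAt).fderiv
    simp only [Function.comp_def] at h7
    rw [h7]
    rfl

/-- The bijection between the two ranges extends to a permutation of all slots, under which the
derivative is symmetric. -/
theorem iteratedFDeriv_extend {f : E → E} (hf : ContDiff ℝ (⊤ : ℕ∞) f) (y v : E) {m n : ℕ}
    (Z : Fin m → E) (ι ι' : Fin m ↪ Fin n) :
    iteratedFDeriv ℝ n f y (Function.extend ι Z fun _ => v) =
      iteratedFDeriv ℝ n f y (Function.extend ι' Z fun _ => v) := by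
  classical
  obtain ⟨g, hg⟩ : ∃ g : Equiv.Perm (Fin n), ∀ i, g (ι i) = ι' i := by
    let e : {j // j ∈ Set.range ι} ≃ {j // j ∈ Set.range ι'} :=
      (Equiv.ofInjective ι ι.injective).symm.trans (Equiv.ofInjective ι' ι'.injective)
    refine ⟨e.extendSubtype, fun i => ?_⟩
    rw [Equiv.extendSubtype_apply_of_mem _ _ ⟨i, rfl⟩]
    simp [e, Equiv.ofInjective_symm_apply]
  rw [← iteratedFDeriv_perm hf y n g (Function.extend ι' Z fun _ => v)]
  congr 1
  funext j
  rw [Function.comp_apply]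
  by_cases hj : ∃ i, ι i = j
  · obtain ⟨i, rfl⟩ := hj
    rw [hg, ι.injective.extend_apply, ι'.injective.extend_apply]
  · rw [Function.extend_apply' _ _ _ hj, Function.extend_apply']
    rintro ⟨i, hi⟩
    rw [← hg] at hi
    exact hj ⟨i, g.injective hi⟩

/-- The expansion of `f⁽ᵐ⁾(y + δ(h)) (Z(h))` in powers of `δ(h) = O(h)`. -/
theorem iteratedFDeriv_add_eqMod [CompleteSpace F] {f : E → F} (hf : ContDiff ℝ (⊤ : ℕ∞) f)
    (y : E) (m N : ℕ)
    {δ : ℝ → E} (hδ : δ =O[𝓝 0] fun h : ℝ => h) {Z : ℝ → Fin m → E} (hZ : ContinuousAt Z 0) :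
    EqMod N (fun h => iteratedFDeriv ℝ m f (y + δ h) (Z h)) fun h =>
      ∑ k ∈ Finset.range (N + 1),
        (k.factorial : ℝ)⁻¹ • iteratedFDeriv ℝ (m + k) f y (prepend (δ h) (Z h) k) := by
  have hδ0 : Tendsto δ (𝓝 0) (𝓝 0) := hδ.trans_tendsto tendsto_id
  -- Taylor's formula is applied to `f⁽ᵐ⁾` as a map into multilinear maps; evaluating at the bounded
  -- `Z h` preserves the order of the error.
  have h1 := (taylor_isBigO (contDiff_iteratedFDeriv hf m) y N).comp_tendsto hδ0
  have h2 := h1.trans (hδ.norm_left.pow (N + 1))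
  have h3 : (fun h => ∏ i, ‖Z h i‖) =O[𝓝 0] fun _ => (1 : ℝ) := by
    have : ContinuousAt (fun h => ∏ i, ‖Z h i‖) 0 :=
      tendsto_finsetProd _ fun i _ => ((continuousAt_pi.1 hZ i).norm)
    exact this.isBigO_one ℝ
  refine ((IsBigO.of_norm_le fun h => ?_).trans (h2.norm_left.mul h3)).trans
    (isBigO_of_le _ fun h => by simp)
  have := ((iteratedFDeriv ℝ m f (y + δ h)) - ∑ k ∈ Finset.range (N + 1),
      (k.factorial : ℝ)⁻¹ • iteratedFDeriv ℝ k (iteratedFDeriv ℝ m f) y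
        fun _ => δ h).le_opNorm (Z h)
  refine le_trans (le_of_eq ?_) this
  rw [sub_apply, sum_apply]
  simp only [smul_apply, iteratedFDeriv_iteratedFDeriv_apply hf]

end

/-! ### Elementary differentials along a B-series -/

section

variable {E : Type*} [NormedAddCommGroup E] [NormedSpace ℝ E]

theorem PlaneTree.contDiff_elemDiff {f : E → E} (hf : ContDiff ℝ (⊤ : ℕ∞) f) :
    (p : PlaneTree) → ContDiff ℝ (⊤ : ℕ∞) (p.elemDiff f)
  | node n c => by
    have h1 : ContDiff ℝ (⊤ : ℕ∞) fun y => fun i => (c i).elemDiff f y :=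
      contDiff_pi.2 fun i => contDiff_elemDiff hf (c i)
    -- Evaluation at a tuple is regarded as a multilinear function of the tuple with values in
    -- linear functionals of the multilinear map, hence depends smoothly on the tuple.
    have h2 := (ContinuousMultilinearMap.contDiff (n := ((⊤ : ℕ∞) : WithTop ℕ∞))
      (F := ContinuousMultilinearMap ℝ (fun _ : Fin n => E) E →L[ℝ] E)
      (ContinuousLinearMap.id ℝ
        (ContinuousMultilinearMap ℝ (fun _ : Fin n => E) E)).flipMultilinear).comp h1
    have h3 : (node n c).elemDiff f =
        fun y => iteratedFDeriv ℝ n f y fun i => (c i).elemDiff f y := by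
      funext y
      rw [elemDiff]
    rw [h3]
    exact h2.clm_apply (contDiff_iteratedFDeriv hf n)

/-- Terms of high order in `h` may be dropped from a finite sum. -/
theorem eqMod_sum_filter {ι : Type*} (N : ℕ) (s : Finset ι) (deg : ι → ℕ) (v : ι → E) :
    EqMod N (fun h => ∑ i ∈ s, h ^ deg i • v i)
      (fun h => ∑ i ∈ s with deg i ≤ N, h ^ deg i • v i) := by
  simp only [Finset.sum_filter]
  refine EqMod.sum fun i _ => ?_
  split_ifs with hi
  · exact EqMod.refl _
  · exact eqMod_pow_smul (not_le.1 hi) _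

/-- The sum of `h^|p| (a(p) / w(p)) F(p)(y₀)` over the plane trees `p` of order at most `N`. -/
noncomputable def treeSum (f : E → E) (y₀ : E) (N : ℕ) (a : PlaneTree → ℝ) (h : ℝ) : E :=
  ∑ p ∈ treesUpTo N, h ^ p.order • ((p.weight : ℝ)⁻¹ * a p) • p.elemDiff f y₀

theorem continuous_treeSum (f : E → E) (y₀ : E) (N : ℕ) (a : PlaneTree → ℝ) :
    Continuous (treeSum f y₀ N a) := by
  unfold treeSum
  fun_prop

theorem treeSum_isBigO (f : E → E) (y₀ : E) (N : ℕ) (a : PlaneTree → ℝ) :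
    treeSum f y₀ N a =O[𝓝 0] fun h : ℝ => h := by
  refine IsBigO.fun_sum fun p _ => ?_
  have := (eqMod_pow_smul (N := 0) p.order_pos (((p.weight : ℝ)⁻¹ * a p) • p.elemDiff f y₀))
  simpa [EqMod] using this

/-- The homomorphism `a` applied to the sum over all embeddings of the forests left over. -/
noncomputable def BStar.embeddingSum (a : BStar) (p' p : PlaneTree) : ℝ :=
  a.extend (PlaneTree.embeddingSum p' p)

theorem BStar.embeddingSum_node (a : BStar) {m n : ℕ} (c : Fin m → PlaneTree)
    (d : Fin n → PlaneTree) :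
    a.embeddingSum (node m c) (node n d) = ∑ ι : Fin m ↪ Fin n,
      ∏ j, Function.extend ι (fun i => a.embeddingSum (c i))
        (fun _ p => a (some (RTree.mk p))) j (d j) := by
  rw [embeddingSum, PlaneTree.embeddingSum_node, map_sum]
  refine Finset.sum_congr rfl fun ι _ => ?_
  rw [map_prod]
  refine Finset.prod_congr rfl fun j _ => ?_
  by_cases hj : ∃ i, ι i = j
  · obtain ⟨i, rfl⟩ := hj
    rw [ι.injective.extend_apply, ι.injective.extend_apply]
    rfl
  · rw [Function.extend_apply' _ _ _ hj, Function.extend_apply' _ _ _ hj]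
    simp [BStar.extend]

theorem extend_treeSum (f : E → E) (y₀ : E) (N : ℕ) {m n : ℕ} (ι : Fin m ↪ Fin n)
    (b : Fin m → PlaneTree → ℝ) (a : PlaneTree → ℝ) (h : ℝ) :
    (Function.extend ι (fun i => treeSum f y₀ N (b i) h) fun _ => treeSum f y₀ N a h) =
      fun j => treeSum f y₀ N (Function.extend ι b (fun _ => a) j) h := by
  funext j
  by_cases hj : ∃ i, ι i = j
  · obtain ⟨i, rfl⟩ := hj
    rw [ι.injective.extend_apply, ι.injective.extend_apply]
  · rw [Function.extend_apply' _ _ _ hj, Function.extend_apply' _ _ _ hj]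

/-- The extra `h` accounts for the new root and `1 / n!` for its factor in the weight; the rest is
multilinearity. -/
theorem iteratedFDeriv_treeSum (f : E → E) (y₀ : E) (N n : ℕ) (b : Fin n → PlaneTree → ℝ)
    (h : ℝ) :
    h • (n.factorial : ℝ)⁻¹ • iteratedFDeriv ℝ n f y₀ (fun j => treeSum f y₀ N (b j) h) =
      ∑ d ∈ Fintype.piFinset fun _ : Fin n => treesUpTo N,
        h ^ (node n d).order •
          (((node n d).weight : ℝ)⁻¹ * ∏ j, b j (d j)) • (node n d).elemDiff f y₀ := by
  classical
  simp only [treeSum]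
  rw [smul_smul, ContinuousMultilinearMap.map_sum_finset, Finset.smul_sum]
  refine Finset.sum_congr rfl fun d _ => ?_
  simp only [smul_smul]
  rw [ContinuousMultilinearMap.map_smul_univ, smul_smul, elemDiff]
  congr 1
  rw [order_node, weight, pow_add, pow_one, ← Finset.prod_pow_eq_pow_sum]
  push_cast
  simp only [Finset.prod_mul_distrib, mul_inv, Finset.prod_inv_distrib]
  ring

/-- All `(m + k)! / k!` placements contribute equally. This turns the Taylor factor `1 / k!` into
the weight `1 / (m + k)!` of a root with `m + k` branches. -/
theorem sum_embeddings_iteratedFDeriv {f : E → E} (hf : ContDiff ℝ (⊤ : ℕ∞) f) (y v : E)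
    {m k : ℕ} (Z : Fin m → E) (ι₀ : Fin m ↪ Fin (m + k)) :
    (((m + k).factorial : ℝ)⁻¹) • ∑ ι : Fin m ↪ Fin (m + k),
      iteratedFDeriv ℝ (m + k) f y (Function.extend ι Z fun _ => v) =
    (k.factorial : ℝ)⁻¹ • iteratedFDeriv ℝ (m + k) f y (Function.extend ι₀ Z fun _ => v) := by
  rw [Finset.sum_congr rfl fun ι _ => iteratedFDeriv_extend hf y v Z ι ι₀, Finset.sum_const,
    Finset.card_univ, Fintype.card_embedding_eq, Fintype.card_fin, Fintype.card_fin,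
    ← Nat.cast_smul_eq_nsmul ℝ, smul_smul]
  congr 1
  have h := Nat.factorial_mul_descFactorial (Nat.le_add_right m k)
  rw [Nat.add_sub_cancel_left] at h
  have h1 : ((m + k).factorial : ℝ) ≠ 0 := Nat.cast_ne_zero.2 (Nat.factorial_ne_zero _)
  have h2 : (k.factorial : ℝ) ≠ 0 := Nat.cast_ne_zero.2 (Nat.factorial_ne_zero _)
  field_simp
  rw [mul_comm]
  exact_mod_cast h

/-- The plane trees with less than `M` branches, all of which have order at most `N`. -/
noncomputable def treesBranchesUpTo (M N : ℕ) : Finset (Σ n, Fin n → PlaneTree) :=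
  (Finset.range M).sigma fun n => Fintype.piFinset fun _ : Fin n => treesUpTo N

theorem sum_treesBranchesUpTo_filter {α : Type*} [AddCommMonoid α] {M N : ℕ} (hM : N ≤ M)
    (φ : PlaneTree → α) :
    ∑ x ∈ treesBranchesUpTo M N with (node x.1 x.2).order ≤ N, φ (node x.1 x.2) =
      ∑ p ∈ treesUpTo N, φ p := by
  classical
  refine Finset.sum_bij (fun x _ => node x.1 x.2) ?_ ?_ ?_ fun _ _ => rfl
  · intro x hx
    exact mem_treesUpTo.2 (Finset.mem_filter.1 hx).2
  · rintro ⟨n, c⟩ _ ⟨m, d⟩ _ h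
    cases h
    rfl
  · rintro ⟨n, d⟩ hp
    rw [mem_treesUpTo] at hp
    refine ⟨⟨n, d⟩, ?_, rfl⟩
    simp only [treesBranchesUpTo, Finset.mem_filter, Finset.mem_sigma, Finset.mem_range,
      Fintype.mem_piFinset, mem_treesUpTo]
    refine ⟨⟨?_, fun i => ?_⟩, hp⟩
    · rw [order_node] at hp
      have : n ≤ ∑ i, (d i).order := by
        calc n = ∑ _i : Fin n, 1 := by simp
          _ ≤ _ := Finset.sum_le_sum fun i _ => (d i).order_pos
      omega
    · rw [order_node] at hp
      have := Finset.single_le_sum (f := fun i => (d i).order) (fun _ _ => Nat.zero_le _)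
        (Finset.mem_univ i)
      omega

/-- The expansion of an elementary differential along a B-series. -/
theorem elemDiff_eqMod [CompleteSpace E] {f : E → E} (hf : ContDiff ℝ (⊤ : ℕ∞) f) (y₀ : E)
    (N : ℕ) (a : BStar) : (p' : PlaneTree) →
    EqMod N (fun h => h ^ p'.order •
        p'.elemDiff f (y₀ + treeSum f y₀ N (fun p => a (some (RTree.mk p))) h))
      (treeSum f y₀ N (a.embeddingSum p'))
  | node m c => by
    set δ := treeSum f y₀ N fun p => a (some (RTree.mk p)) with hδ
    set Z : ℝ → Fin m → E := fun h i => h ^ (c i).order • (c i).elemDiff f (y₀ + δ h) with hZ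
    set Z' : ℝ → Fin m → E := fun h i => treeSum f y₀ N (a.embeddingSum (c i)) h with hZ'
    have hδc : Continuous δ := continuous_treeSum _ _ _ _
    have hZc : Continuous Z := continuous_pi fun i => by
      have := (contDiff_elemDiff hf (c i)).continuous
      fun_prop
    have hZ'c : Continuous Z' := continuous_pi fun i => continuous_treeSum _ _ _ _
    choose ι₀ hι₀ using prepend_eq_extend E m
    -- One power of `h` belongs to the root; the others are absorbed into the arguments `Z h`, in
    -- the form needed by the induction hypothesis.
    have h1 : (fun h => h ^ (node m c).order • (node m c).elemDiff f (y₀ + δ h)) =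
        fun h => h • iteratedFDeriv ℝ m f (y₀ + δ h) (Z h) := by
      funext h
      rw [ContinuousMultilinearMap.map_smul_univ, elemDiff, smul_smul, order_node, pow_add,
        pow_one, Finset.prod_pow_eq_pow_sum]
    have hext : ∀ {k : ℕ} (ι : Fin m ↪ Fin k) {W : ℝ → Fin m → E}, Continuous W →
        Continuous fun h => Function.extend ι (W h) fun _ => δ h := by
      intro k ι W hW
      refine continuous_pi fun j => ?_
      by_cases hj : ∃ i, ι i = j
      · obtain ⟨i, rfl⟩ := hj
        simp only [ι.injective.extend_apply]
        exact (continuous_pi_iff.1 hW) i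
      · simp only [Function.extend_apply' _ _ _ hj]
        exact hδc
    have h2 : EqMod N (fun h => iteratedFDeriv ℝ m f (y₀ + δ h) (Z h)) fun h =>
        ∑ k ∈ Finset.range (N + 1), (k.factorial : ℝ)⁻¹ •
          iteratedFDeriv ℝ (m + k) f y₀ (Function.extend (ι₀ k) (Z' h) fun _ => δ h) := by
      refine (iteratedFDeriv_add_eqMod hf y₀ m N (treeSum_isBigO _ _ _ _)
        hZc.continuousAt).trans (EqMod.sum fun k _ => EqMod.smul continuousAt_const ?_)
      simp only [hι₀]
      refine EqMod.map_multilinear _ (hext _ hZc).continuousAt (hext _ hZ'c).continuousAt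
        fun j => ?_
      by_cases hj : ∃ i, ι₀ k i = j
      · obtain ⟨i, rfl⟩ := hj
        simp only [(ι₀ k).injective.extend_apply]
        exact elemDiff_eqMod hf y₀ N a (c i)
      · simp only [Function.extend_apply' _ _ _ hj]
        exact EqMod.refl _
    -- The trees that arise have `n = m + k` branches with `k ≤ N`. Those with `n < m` may be added
    -- freely, as there is no placement and the coefficient vanishes.
    have h3 : (fun h : ℝ => h • ∑ k ∈ Finset.range (N + 1), (k.factorial : ℝ)⁻¹ •
          iteratedFDeriv ℝ (m + k) f y₀ (Function.extend (ι₀ k) (Z' h) fun _ => δ h)) =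
        fun h => ∑ x ∈ treesBranchesUpTo (m + (N + 1)) N, h ^ (node x.1 x.2).order •
          (((node x.1 x.2).weight : ℝ)⁻¹ * a.embeddingSum (node m c) (node x.1 x.2)) •
            (node x.1 x.2).elemDiff f y₀ := by
      funext h
      have h4 : ∀ n, ∑ d ∈ Fintype.piFinset fun _ : Fin n => treesUpTo N,
          h ^ (node n d).order • (((node n d).weight : ℝ)⁻¹ *
            a.embeddingSum (node m c) (node n d)) • (node n d).elemDiff f y₀ =
          h • (n.factorial : ℝ)⁻¹ • ∑ ι : Fin m ↪ Fin n,
            iteratedFDeriv ℝ n f y₀ (Function.extend ι (Z' h) fun _ => δ h) := fun n => by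
        simp only [hZ', hδ, extend_treeSum, Finset.smul_sum, iteratedFDeriv_treeSum]
        rw [Finset.sum_comm]
        refine Finset.sum_congr rfl fun d _ => ?_
        rw [a.embeddingSum_node, Finset.mul_sum, Finset.sum_smul, Finset.smul_sum]
      rw [treesBranchesUpTo, Finset.sum_sigma]
      simp only [h4]
      rw [Finset.sum_range_add _ m (N + 1), Finset.sum_eq_zero (s := Finset.range m),
        zero_add, Finset.smul_sum]
      · exact Finset.sum_congr rfl fun k _ => by
          rw [sum_embeddings_iteratedFDeriv hf y₀ (δ h) (Z' h) (ι₀ k)]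
      · intro n hn
        have : IsEmpty (Fin m ↪ Fin n) := by
          rw [← Fintype.card_eq_zero_iff, Fintype.card_embedding_eq, Fintype.card_fin,
            Fintype.card_fin, Nat.descFactorial_eq_zero_iff_lt]
          exact Finset.mem_range.1 hn
        simp
    rw [h1]
    refine (EqMod.smul continuousAt_id h2).trans ?_
    simp only [id]
    rw [h3]
    -- The expansion produces trees of order above `N`, which are negligible. Conversely no tree of
    -- order at most `N` is missing, since it has fewer than `N` branches.
    refine (eqMod_sum_filter N _ (fun x : Σ n, Fin n → PlaneTree => (node x.1 x.2).order) _).trans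
      ?_
    have h5 : (fun h : ℝ => ∑ x ∈ treesBranchesUpTo (m + (N + 1)) N with
        (node x.1 x.2).order ≤ N, h ^ (node x.1 x.2).order •
          (((node x.1 x.2).weight : ℝ)⁻¹ * a.embeddingSum (node m c) (node x.1 x.2)) •
            (node x.1 x.2).elemDiff f y₀) = treeSum f y₀ N (a.embeddingSum (node m c)) := by
      funext h
      exact sum_treesBranchesUpTo_filter (by omega) fun p => h ^ p.order •
        ((p.weight : ℝ)⁻¹ * a.embeddingSum (node m c) p) • p.elemDiff f y₀
    rw [h5]
    exact EqMod.refl _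

/-- The formal composition `g(Y)` is the Taylor expansion of `g` along `∑ hᵏ Yₖ`. -/
theorem formalEval_eqMod [CompleteSpace E] {g : E → E} (hg : ContDiff ℝ (⊤ : ℕ∞) g)
    (Y : FormalSeries E) (N : ℕ) :
    EqMod N (fun h => g (∑ k ∈ Finset.range (N + 1), h ^ k • Y k))
      (fun h => ∑ n ∈ Finset.range (N + 1), h ^ n • formalEval g Y n) := by
  classical
  set δ : ℝ → E := fun h => ∑ k ∈ Finset.Ico 1 (N + 1), h ^ k • Y k with hδ
  have h0 : ∀ h : ℝ, ∑ k ∈ Finset.range (N + 1), h ^ k • Y k = Y 0 + δ h := fun h => by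
    rw [Finset.range_eq_Ico, Finset.sum_eq_sum_Ico_succ_bot (Nat.succ_pos N), pow_zero, one_smul]
  have hO : δ =O[𝓝 0] fun h : ℝ => h := by
    refine IsBigO.fun_sum fun k hk => ?_
    simpa [EqMod] using eqMod_pow_smul (N := 0) (Finset.mem_Ico.1 hk).1 (Y k)
  have h1 := ((taylor_isBigO hg (Y 0) N).comp_tendsto (hO.trans_tendsto tendsto_id)).trans
    (hO.norm_left.pow (N + 1))
  let term : (Σ n, Composition n) → E := fun e =>
    (e.2.length.factorial : ℝ)⁻¹ • iteratedFDeriv ℝ e.2.length g (Y 0) fun i =>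
      Y (e.2.blocksFun i)
  have hterm : ∀ (e : Σ n, Composition n) (k : ℕ) (r : Fin k → ℕ) (hl : e.2.length = k),
      (∀ j : Fin k, e.2.blocksFun ⟨j, hl.symm ▸ j.2⟩ = r j) →
      (k.factorial : ℝ)⁻¹ • iteratedFDeriv ℝ k g (Y 0) (fun i => Y (r i)) = term e := by
    rintro ⟨n, e⟩ k r hl hb
    simp only at hl hb
    subst hl
    simp only [term, ← hb]
  -- Expanding the powers of `δ` gives tuples of exponents in `[1, N]`, that is, compositions with
  -- bounded length and blocks, reindexed by the change of variables for composing power series.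
  have h2 : ∀ h : ℝ, ∑ k ∈ Finset.range (N + 1),
      (k.factorial : ℝ)⁻¹ • iteratedFDeriv ℝ k g (Y 0) (fun _ => δ h) =
      ∑ e ∈ FormalMultilinearSeries.compPartialSumTarget 0 (N + 1) (N + 1), h ^ e.1 • term e :=
    fun h => by
    rw [← FormalMultilinearSeries.compChangeOfVariables_sum 0 (N + 1) (N + 1)
      (fun r => h ^ (∑ i, r.2 i) • (r.1.factorial : ℝ)⁻¹ •
        iteratedFDeriv ℝ r.1 g (Y 0) fun i => Y (r.2 i))]
    · rw [FormalMultilinearSeries.compPartialSumSource, Finset.sum_sigma, Finset.range_eq_Ico]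
      refine Finset.sum_congr rfl fun k _ => ?_
      simp only [hδ]
      rw [ContinuousMultilinearMap.map_sum_finset, Finset.smul_sum]
      refine Finset.sum_congr rfl fun r _ => ?_
      rw [ContinuousMultilinearMap.map_smul_univ, Finset.prod_pow_eq_pow_sum, smul_comm]
    · rintro ⟨k, r⟩ he
      congr 1
      exact hterm _ k r (FormalMultilinearSeries.compChangeOfVariables_length 0 (N + 1) (N + 1) he)
        (FormalMultilinearSeries.compChangeOfVariables_blocksFun 0 (N + 1) (N + 1) he)
  -- A composition of `n ≤ N` has length and blocks at most `N`, so the bounds exclude none of them.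
  have h3 : ∀ h : ℝ, ∑ e ∈ FormalMultilinearSeries.compPartialSumTarget 0 (N + 1) (N + 1) with
      e.1 ≤ N, h ^ e.1 • term e = ∑ n ∈ Finset.range (N + 1), h ^ n • formalEval g Y n :=
    fun h => by
    have : (FormalMultilinearSeries.compPartialSumTarget 0 (N + 1) (N + 1)).filter
        (fun e => e.1 ≤ N) = (Finset.range (N + 1)).sigma fun _ => Finset.univ := by
      ext ⟨n, e⟩
      simp only [Finset.mem_filter, FormalMultilinearSeries.mem_compPartialSumTarget_iff,
        Finset.mem_sigma, Finset.mem_range, Finset.mem_univ, and_true]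
      refine ⟨fun h => Nat.lt_succ_of_le h.2, fun h => ⟨⟨Nat.zero_le _, ?_, fun j => ?_⟩,
        Nat.le_of_lt_succ h⟩⟩
      · exact e.length_le.trans_lt h
      · exact (e.blocksFun_le j).trans_lt h
    rw [this, Finset.sum_sigma]
    refine Finset.sum_congr rfl fun n _ => ?_
    rw [formalEval, Finset.smul_sum]
  simp only [h0, ← h3]
  refine EqMod.trans ?_ (eqMod_sum_filter N _ (fun e : Σ n, Composition n => e.1) term)
  simp only [← h2]
  exact h1

/-! ### Comparison of coefficients -/

theorem treeSum_eq_sum_treesOfOrder {f : E → E} (hf : ContDiff ℝ (⊤ : ℕ∞) f) (y₀ : E) (N : ℕ)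
    (a : RTree → ℝ) (h : ℝ) :
    treeSum f y₀ N (fun p => a (RTree.mk p)) h = ∑ k ∈ Finset.range (N + 1),
      h ^ k • ∑ t ∈ treesOfOrder k, (t.symmetry : ℝ)⁻¹ • a t • t.elemDiff f y₀ := by
  rw [treeSum, ← Finset.sum_fiberwise_of_maps_to (t := Finset.range (N + 1)) (g := order)]
  · refine Finset.sum_congr rfl fun k hk => ?_
    rw [sum_treesOfOrder, Finset.smul_sum]
    have : (treesUpTo N).filter (fun p => p.order = k) =
        (treesUpTo k).filter fun p => p.order = k := by
      ext p
      have := Finset.mem_range.1 hk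
      simp only [Finset.mem_filter, mem_treesUpTo]
      omega
    rw [this]
    refine Finset.sum_congr rfl fun p hp => ?_
    rw [(Finset.mem_filter.1 hp).2, RTree.elemDiff_mk hf, mul_smul]
  · intro p hp
    exact Finset.mem_range.2 (Nat.lt_succ_of_le (mem_treesUpTo.1 hp))

theorem BStar.embeddingSum_eq (a : BStar) (p' p : PlaneTree) :
    a.embeddingSum p' p =
      (RTree.mk p').symmetry * a.extend ((RTree.mk p).prune (RTree.mk p')) := by
  rw [embeddingSum, PlaneTree.embeddingSum_eq, map_mul, map_natCast]
  rfl

/-- The coefficients of `F(t')(Y)` for a B-series `Y`. -/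
theorem formalEval_elemDiff_bSeries [CompleteSpace E] {f : E → E}
    (hf : ContDiff ℝ (⊤ : ℕ∞) f) (y₀ : E) {a : BStar} (ha : a ∈ B) (t' : RTree) (n : ℕ)
    (hn : t'.order ≤ n) :
    (t'.symmetry : ℝ)⁻¹ • formalEval (t'.elemDiff f) (bSeries f y₀ a) (n - t'.order) =
      ∑ t ∈ treesOfOrder n,
        (t.symmetry : ℝ)⁻¹ • a.extend (t.prune t') • t.elemDiff f y₀ := by
  obtain ⟨p', rfl⟩ := t'.exists_mk
  obtain ⟨l, hl⟩ := Nat.exists_eq_add_of_le hn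
  rw [RTree.order_mk] at hl
  set Y := bSeries f y₀ a with hY
  set g := (RTree.mk p').elemDiff f with hg
  have hgp : g = p'.elemDiff f := RTree.elemDiff_mk hf p'
  -- Here `a(∅) = 1` is needed: the constant term of the series must be `y₀`, the point at which the
  -- Taylor expansions are centred.
  have hY' : ∀ h : ℝ, ∑ k ∈ Finset.range (n + 1), h ^ k • Y k =
      y₀ + treeSum f y₀ n (fun p => a (some (RTree.mk p))) h := fun h => by
    rw [treeSum_eq_sum_treesOfOrder hf y₀ n fun t => a (some t)]
    simp only [hY, bSeries, smul_add, Finset.sum_add_distrib]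
    congr 1
    · rw [Finset.sum_eq_single 0]
      · simp [show a none = 1 from ha]
      · intro k _ hk
        simp [hk]
      · simp
    · refine Finset.sum_congr rfl fun k _ => ?_
      congr 1
      refine Finset.sum_congr rfl fun t _ => ?_
      rw [smul_smul, div_eq_inv_mul]
  have h1 := elemDiff_eqMod hf y₀ n a p'
  simp only [← hY', ← hgp] at h1
  have h2 := EqMod.smul (c := fun h => h ^ p'.order) (by fun_prop)
    (formalEval_eqMod (hgp ▸ contDiff_elemDiff hf p') Y n)
  have h3 : (treeSum f y₀ n (a.embeddingSum p')) = fun h => ∑ k ∈ Finset.range (n + 1), h ^ k •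
      ∑ t ∈ treesOfOrder k, (t.symmetry : ℝ)⁻¹ •
        ((RTree.mk p').symmetry * a.extend (t.prune (RTree.mk p'))) • t.elemDiff f y₀ := by
    funext h
    rw [← treeSum_eq_sum_treesOfOrder hf]
    simp only [← a.embeddingSum_eq]
  -- Multiplication by `h ^ p'.order` shifts the coefficients; those pushed beyond `h ^ n` are
  -- dropped.
  have h4 : EqMod n
      (fun h => h ^ p'.order • ∑ k ∈ Finset.range (n + 1), h ^ k • formalEval g Y k)
      (fun h => ∑ k ∈ Finset.range (n + 1),
        h ^ k • if p'.order ≤ k then formalEval g Y (k - p'.order) else 0) := by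
    have h5 : (fun h : ℝ => ∑ k ∈ Finset.range (n + 1),
        h ^ k • if p'.order ≤ k then formalEval g Y (k - p'.order) else 0) =
        fun h => ∑ k ∈ Finset.range (n + 1) with p'.order + k ≤ n,
          h ^ (p'.order + k) • formalEval g Y k := by
      funext h
      have h6 : (Finset.range (n + 1)).filter (fun k => p'.order + k ≤ n) =
          Finset.range (l + 1) := by
        ext k
        simp only [Finset.mem_filter, Finset.mem_range]
        omega
      rw [h6, show n + 1 = p'.order + (l + 1) by omega, Finset.sum_range_add,
        Finset.sum_eq_zero, zero_add]
      · refine Finset.sum_congr rfl fun k _ => ?_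
        rw [if_pos (Nat.le_add_right _ _), Nat.add_sub_cancel_left]
      · intro k hk
        rw [if_neg (not_le.2 (Finset.mem_range.1 hk)), smul_zero]
    rw [h5]
    simp only [Finset.smul_sum, smul_smul, ← pow_add]
    exact eqMod_sum_filter n _ (fun k => p'.order + k) _
  -- The truncation order was taken to be `n` itself, so the coefficient of `h ^ n` is the last one
  -- determined.
  have h7 := coeff_eq_of_eqMod ((h4.symm.trans h2.symm).trans (h3 ▸ h1)) le_rfl
  rw [RTree.order_mk] at hn ⊢
  rw [if_pos hn] at h7
  rw [h7, Finset.smul_sum]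
  -- The multiplicity `σ(t')` of each copy cancels against the factor `1 / σ(t')` of the B-series.
  have hσ : ((RTree.mk p').symmetry : ℝ) ≠ 0 :=
    Nat.cast_ne_zero.2 (symmetry_pos p').ne'
  refine Finset.sum_congr rfl fun t _ => ?_
  simp only [smul_smul]
  congr 1
  field_simp

/-! ### The composition formula -/

theorem RTree.mem_subtrees {t' t : RTree} : t' ∈ t.subtrees ↔ t' ≤ t := by
  simp [subtrees]

theorem RTree.prune_eq_zero {t' t : RTree} (h : ¬ t' ≤ t) : t.prune t' = 0 := by
  obtain ⟨p, rfl⟩ := t.exists_mk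
  obtain ⟨p', rfl⟩ := t'.exists_mk
  rw [prune_mk, PlaneTree.prune, Finset.sum_eq_zero]
  intro S hS
  simp only [copies, Finset.mem_filter, Finset.mem_univ, true_and] at hS
  obtain ⟨π, hπ, -⟩ := hS
  exact (h ⟨p', p, rfl, rfl, π, hπ⟩).elim

/-- The composition `ab` of `a ∈ B` and `b ∈ B*`. -/
noncomputable def BStar.comp (a b : BStar) : BStar
  | none => b none
  | some t => b none * a (some t) + ∑ t' ∈ t.subtrees, b (some t') * a.extend (t.prune t')

/-- Trees that are not subtrees have zero pruning, so the range can be enlarged to all trees of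
bounded order, as produced by the Cauchy product. -/
theorem sum_subtrees (a b : BStar) (t : RTree) :
    ∑ t' ∈ t.subtrees, b (some t') * a.extend (t.prune t') =
      ∑ k ∈ Finset.range (t.order + 1), ∑ t' ∈ treesOfOrder k,
        b (some t') * a.extend (t.prune t') := by
  classical
  rw [← Finset.sum_fiberwise_of_maps_to (t := Finset.range (t.order + 1)) (g := RTree.order)]
  · refine Finset.sum_congr rfl fun k _ => Finset.sum_subset (fun t' ht' => ?_) fun t' ht' h => ?_
    · exact mem_treesOfOrder.2 (Finset.mem_filter.1 ht').2
    · have hle : ¬ t' ≤ t := fun hle =>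
        h (Finset.mem_filter.2 ⟨RTree.mem_subtrees.2 hle, mem_treesOfOrder.1 ht'⟩)
      rw [RTree.prune_eq_zero hle, map_zero, mul_zero]
  · intro t' ht'
    exact Finset.mem_range.2 (Nat.lt_succ_of_le (RTree.order_le_of_le (RTree.mem_subtrees.1 ht')))

/-- Composition of B-series. -/
theorem bSeriesAt_bSeries [CompleteSpace E] {f : E → E} (hf : ContDiff ℝ (⊤ : ℕ∞) f) (y₀ : E)
    {a : BStar} (ha : a ∈ B) (b : BStar) :
    bSeriesAt f (bSeries f y₀ a) b = bSeries f y₀ (a.comp b) := by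
  funext n
  rw [bSeriesAt, Finset.Nat.sum_antidiagonal_eq_sum_range_succ
    (fun i j => ∑ t ∈ treesOfOrder i,
      (b (some t) / t.symmetry) • formalEval (t.elemDiff f) (bSeries f y₀ a) j)]
  -- Each `F(t')` is expanded along the inner series; exchanging the sums over `t'` and `t` then
  -- collects the coefficient of each `F(t)(y₀)`.
  have h1 : ∀ k ∈ Finset.range (n + 1), ∑ t' ∈ treesOfOrder k,
      (b (some t') / t'.symmetry) • formalEval (t'.elemDiff f) (bSeries f y₀ a) (n - k) =
      ∑ t ∈ treesOfOrder n, ∑ t' ∈ treesOfOrder k,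
        (b (some t') * a.extend (t.prune t') / t.symmetry) • t.elemDiff f y₀ := by
    intro k hk
    rw [Finset.sum_comm]
    refine Finset.sum_congr rfl fun t' ht' => ?_
    rw [mem_treesOfOrder] at ht'
    subst ht'
    rw [div_eq_mul_inv, mul_smul, formalEval_elemDiff_bSeries hf y₀ ha t' n
      (Nat.le_of_lt_succ (Finset.mem_range.1 hk)), Finset.smul_sum]
    refine Finset.sum_congr rfl fun t _ => ?_
    simp only [smul_smul]
    congr 1
    ring
  rw [Finset.sum_congr rfl h1, Finset.sum_comm, bSeries, bSeries, smul_add, add_assoc]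
  congr 1
  · simp only [BStar.comp, show a none = 1 from ha]
    split_ifs <;> simp
  · rw [Finset.smul_sum, ← Finset.sum_add_distrib]
    refine Finset.sum_congr rfl fun t ht => ?_
    rw [mem_treesOfOrder] at ht
    subst ht
    simp only [BStar.comp, sum_subtrees, ← Finset.sum_smul, smul_smul, ← add_smul,
      ← Finset.sum_div]
    congr 1
    ring

end

end BSeries

theorem theorem1 (a : BSeries.BStar) (ha : a ∈ BSeries.B) (b : BSeries.BStar) :
    ∃ ab : BSeries.BStar,
      ab none = b none ∧
      (∀ t : BSeries.RTree,
        ab (some t) = b none * a (some t) +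
          ∑ t' ∈ t.subtrees, b (some t') * a.extend (t.prune t')) ∧
      ∀ (d : ℕ) (f : EuclideanSpace ℝ (Fin d) → EuclideanSpace ℝ (Fin d)),
        ContDiff ℝ (⊤ : ℕ∞) f → ∀ y₀ : EuclideanSpace ℝ (Fin d),
          BSeries.bSeriesAt f (BSeries.bSeries f y₀ a) b = BSeries.bSeries f y₀ ab :=
  ⟨a.comp b, rfl, fun _ => rfl, fun _ _ hf y₀ => BSeries.bSeriesAt_bSeries hf y₀ ha b⟩
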